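/- Let $q$ be a prime power, let $m>1$ be a divisor of $n$, and let $k\ge 1$ be an integer with $\gcd(k,n)=1$. Regard $\mathbb F_{q^m}$ as the subfield of order $q^m$ of $\mathbb F_{q^n}$, and let $\Omega$ be the $\mathbb F_q$-vector space of all $\mathbb F_q$-bilinear forms $f:\mathbb F_{q^m}\times\mathbb F_{q^n}\to\mathbb F_q$. The rank of $f\in\Omega$ is the codimension in $\mathbb F_{q^m}$ of its left radical $\{x : f(x,x')=0 \text{ for all } x'\in\mathbb F_{q^n}\}$. Two subsets of $\Omega$ are called equivalent if one is mapped onto the other by a bijective semilinear (with respect to some automorphism of $\mathbb F_q$) map $\Omega\to\Omega$ that preserves the rank. For $a\in\mathbb F_{q^n}$ and $j\ge 0$ put $f_{a,j}(x,x')=\mathrm{Tr}_{q^n/q}\bigl(a\,x\,x'^{\,q^{kj}}\bigr)$. For $t\ge 1$, $\mu\in\mathbb F_{q^n}$ and $s\in\mathbb Z$, the generalized twisted Gabidulin code is the set of bilinear forms on $\mathbb F_{q^n}\times\mathbb F_{q^n}$ $$\mathcal H^{(k)}_{n,n,t,\mu,s}=\Bigl\{f_{a,0}+\sum_{j=1}^{t-1}f_{c_j,j}+f_{\mu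 a^{q^{sk}},t}\;:\;a,c_1,\dots,c_{t-1}\in\mathbb F_{q^n}\Bigr\}$$ (exponents of $q$ are read modulo $n$), and the punctured code $\mathcal H^{(k)}_{m,n,t,\mu,s}\subseteq\Omega$ is the set of the restrictions of its members to $\mathbb F_{q^m}\times\mathbb F_{q^n}$. A subset of $\Omega$ is called a generalized Gabidulin code if there are integers $j\ge1$ with $\gcd(j,n)=1$ and $1\le \tau\le n$, elements $g_0,\dots,g_{m-1}\in\mathbb F_{q^n}$ linearly independent over $\mathbb F_q$, an $\mathbb F_q$-basis $u$ of $\mathbb F_{q^n}$, and $\mathbb F_q$-bases of $\mathbb F_{q^m}$ and $\mathbb F_{q^n}$ in which the matrices of its members are exactly the $m\times n$ matrices whose $i$-th row ($0\le i\le m-1$) is the coordinate vector, in the basis $u$, of $P(g_i)$, where $P$ runs over all polynomials $P(x)=\sum_{h=0}^{\tau-1}a_h x^{q^{jh}}$ with $a_h\in\mathbb F_{q^n}$. **Theorem.** Let $t\in\{1,\dots,m-2\}$, let $\mu\in\mathbb F_{q^n}$ with $\mu\ne0$ and $\mathrm N_{q^n/q}(\mu)\neq(-1)^{nt}$, and let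 $s$ be an integer with $s\not\equiv 0,\pm1,\pm2\pmod m$ and $\gcd(n,sk-t)<m$. Then the punctured code $\mathcal H^{(k)}_{m,n,t,\mu,s}$ is not equivalent to any generalized Gabidulin code. -/

import Mathlib

namespace RankMetric

/-! ### The rank metric space of bilinear forms and equivalence of codes -/

section Forms

variable {F V V' : Type*} [Field F] [AddCommGroup V] [Module F V] [AddCommGroup V'] [Module F V']

/-- The rank of a bilinear form on `V × V'`: the codimension in `V` of its left radical
`{v | ∀ v', f v v' = 0}`, which is the kernel of `f : V → Hom(V', F)`. -/
noncomputable def formRank (f : V →ₗ[F] V' →ₗ[F] F) : ℕ :=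
  Module.finrank F V - Module.finrank F (LinearMap.ker f)

/-- Two sets of bilinear forms on `V × V'` are equivalent if some automorphism of the rank metric
space, i.e. an invertible semilinear transformation `φ` (with companion automorphism `σ` of `F`)
of the space of all bilinear forms that preserves the rank, maps the first onto the second. -/
def CodeEquivalent (X₁ X₂ : Set (V →ₗ[F] V' →ₗ[F] F)) : Prop :=
  ∃ (σ : F ≃+* F) (φ : (V →ₗ[F] V' →ₗ[F] F) ≃+ (V →ₗ[F] V' →ₗ[F] F)),
    (∀ (c : F) (f : V →ₗ[F] V' →ₗ[F] F), φ (c • f) = σ c • φ f) ∧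
    (∀ f : V →ₗ[F] V' →ₗ[F] F, formRank (φ f) = formRank f) ∧
    φ '' X₁ = X₂

end Forms

section Codes

variable (F : Type*) {L : Type*} [Field F] [Fintype F] [Field L] [Algebra F L]

/-! ### Generalized Gabidulin codes -/

/-- The matrices attached to `g = (g_0, …, g_{m-1})`: for each `q^k`-polynomial
`f = a_0 x + a_1 x^{q^k} + ⋯ + a_{t-1} x^{q^{k(t-1)}}` over `L` the `m × n` matrix whose `i`-th row
consists of the coordinates of `f(g_i)` in the basis `u` of `L` over `F`. -/
def gabidulinMatrices {m n : ℕ} (u : Module.Basis (Fin n) F L) (g : Fin m → L) (t k : ℕ) :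
    Set (Matrix (Fin m) (Fin n) F) :=
  {M | ∃ a : Fin t → L, ∀ (i : Fin m) (l : Fin n),
    M i l = u.repr (∑ h : Fin t, a h * g i ^ (Fintype.card F ^ (k * (h : ℕ)))) l}

/-- A set of bilinear forms on `V × V'` is a generalized Gabidulin code (over the field extension
`L` of `F`, of degree `dim V'`) if in some bases of `V` and `V'` the matrices of its members form
a code `gabidulinMatrices F u g t k` with `1 ≤ t ≤ n`, `1 ≤ k`, `gcd(k, n) = 1` and
`g_0, …, g_{m-1}` linearly independent over `F`. -/
def IsGeneralizedGabidulin (L : Type*) [Field L] [Algebra F L]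
    {V V' : Type*} [AddCommGroup V] [Module F V] [AddCommGroup V'] [Module F V']
    (C : Set (V →ₗ[F] V' →ₗ[F] F)) : Prop :=
  ∃ (m n : ℕ) (b : Module.Basis (Fin m) F V) (b' : Module.Basis (Fin n) F V')
    (u : Module.Basis (Fin n) F L) (g : Fin m → L) (t k : ℕ),
    LinearIndependent F g ∧ 1 ≤ t ∧ t ≤ n ∧ 1 ≤ k ∧ Nat.Coprime k n ∧
    C = {f | LinearMap.toMatrix₂ b b' f ∈ gabidulinMatrices F u g t k}

/-! ### Generalized twisted Gabidulin codes and their puncturing -/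

/-- The bilinear form `f_{a,j}^{(k)}(x, x') = Tr_{L/F}(a x x'^{q^{kj}})` on `L × L`, where `L` is
identified with its `k`-cyclic model through `x ↦ (x, x^{q^k}, …, x^{q^{k(n-1)}})`. -/
noncomputable def traceForm (k : ℕ) (a : L) (j : ℕ) : L →ₗ[F] L →ₗ[F] F :=
  LinearMap.mk₂ F (fun x x' => Algebra.trace F L (a * x * x' ^ (Fintype.card F ^ (k * j))))
    (fun x₁ x₂ y => by rw [← map_add]; congr 1; ring)
    (fun c x y => by
      rw [← map_smul]; congr 1; simp only [Algebra.smul_def]; ring)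
    (fun x y₁ y₂ => by
      have h := map_add (FiniteField.frobeniusAlgHom F L ^ (k * j)) y₁ y₂
      simp only [AlgHom.coe_pow, FiniteField.coe_frobeniusAlgHom, pow_iterate] at h
      rw [h, mul_add, map_add])
    (fun c x y => by
      have h := map_smul (FiniteField.frobeniusAlgHom F L ^ (k * j)) c y
      simp only [AlgHom.coe_pow, FiniteField.coe_frobeniusAlgHom, pow_iterate] at h
      rw [h, mul_smul_comm, map_smul])

variable [FiniteDimensional F L]

/-- The generalized twisted Gabidulin code `H_{n,n,t,μ,s}^{(k)} = Γ ⊕ Ω_1 ⊕ ⋯ ⊕ Ω_{t-1}` in the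
bilinear forms on `L × L`, with `Γ = {f_{a,0} + f_{μ a^{q^{sk}}, t} : a ∈ L}` and
`Ω_j = {f_{c,j} : c ∈ L}`. Since `s` is any integer, `a ↦ a^{q^{sk}}` is written as the power `sk`
of the automorphism `a ↦ a^q` of `L`. -/
def twistedGabidulin (t : ℕ) (μ : L) (s : ℤ) (k : ℕ) : Set (L →ₗ[F] L →ₗ[F] F) :=
  {f | ∃ (a : L) (c : ℕ → L),
    f = traceForm F k a 0
      + traceForm F k
          (μ * (FiniteField.frobeniusAlgEquivOfAlgebraic F L ^ (s * (k : ℤ))) a) t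
      + ∑ j ∈ Finset.Ico 1 t, traceForm F k (c j) j}

/-- The punctured code `H_{m,n,t,μ,s}^{(k)}`: the restrictions to `K × L` of the members of
`H_{n,n,t,μ,s}^{(k)}`, where `K` is the subfield of `L` with `q^m` elements. In the cyclic models,
`x ∈ K` has the coordinates `(x, x^{q^k}, …, x^{q^{k(n-1)}})`, which consist of `n / m` copies of
`(x, x^{q^k}, …, x^{q^{k(m-1)}})`, so this is the puncturing with `(I_m | I_m | ⋯ | I_m)`. -/
def puncturedTwistedGabidulin (K : IntermediateField F L) (t : ℕ) (μ : L) (s : ℤ) (k : ℕ) :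
    Set (K →ₗ[F] L →ₗ[F] F) :=
  (fun f : L →ₗ[F] L →ₗ[F] F => f ∘ₗ K.val.toLinearMap) '' twistedGabidulin F t μ s k

end Codes

end RankMetric

namespace RankMetric

open Finset

/-! ### Expansions in powers of a generator of the Galois group -/

section Expansion

variable {F L : Type*} [Field F] [Field L] [Algebra F L] {K : IntermediateField F L}
  {m : ℕ} [NeZero m]

/-! The trace form turns a bilinear form on `K × L` into an `F`-linear map `K → L`, which is written
uniquely as `∑ v_i χ_i` with `v_i ∈ L` and `χ_i`, `i ∈ ZMod m`, running through the Galois group of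
`K`. The punctured code becomes the set `C` of all `v` supported in `{0, …, t}` with `v_t = N(v_0)`,
where `N` is semilinear over `K` with companion `χ_e`, `e = t - s`
(`mem_puncturedTwistedGabidulin_iff`). A rank-preserving semilinear bijection acts on rank-one forms
through the two factors, possibly exchanged (`rank_preserver_classification`). Hence an equivalence
would identify `C` with the set of all `A ∘ P ∘ γ`, where `A` is a semilinear bijection of `L`, `γ`
is a fixed map and `P` runs over `q^j`-polynomials of bounded degree (`gabidulin_image`).

Such a set is stable under `θ_l = A ∘ (l ·) ∘ A⁻¹` for every `l ∈ L`. Since `e ≠ t`, that is `s ≢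
0`, only the `K`-linear part of `θ_l` can be nonzero (`semilinear_part_eq_zero`). It follows that
multiplications by `K` are among the `θ_l`, so `C` is stable under `K`, and `v_t = N(v_0)` forces `e
= 0`, that is `s ≡ t`.

The remaining conditions on `s` then give `2 ≤ t ≤ m - 3`. With `φ y = y^{q^j}`, the map `ρ = A ∘ φ
∘ A⁻¹` shifts coefficients by some `d ≠ 0`. Separating the lowest term of `P` shows `C` to be
contained in a family parametrized by one copy of `L` plus `C ∩ ρ(C)`. Members of `C ∩ ρ(C)` vanish
in two positions where `C` takes all pairs of values (`exists_two_zeros`,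
`exists_mem_twistedCoeffs`), so `L` would surject onto `L × L`. -/

/-- The map `K → L` with coefficients `v` with respect to a family of automorphisms of `K`. -/
def expand (χ : ZMod m → (K ≃ₐ[F] K)) (v : ZMod m → L) (x : K) : L :=
  ∑ i, v i * (χ i x : L)

variable {χ : ZMod m → (K ≃ₐ[F] K)}

/-- This is Dedekind's independence of characters, applied to the `χ i` followed by the inclusion of
`K` in `L`. -/
theorem expand_injective (hχ : Function.Injective χ) :
    Function.Injective (expand (L := L) χ) := by
  let e : ZMod m → (K →* L) := fun i =>
    ((K.val : K →ₐ[F] L) : K →* L).comp ((χ i : K →ₐ[F] K) : K →* K)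
  have he : Function.Injective e := by
    intro i j h
    apply hχ
    ext x
    exact DFunLike.congr_fun h x
  have hl := (linearIndependent_monoidHom K L).comp e he
  rw [Fintype.linearIndependent_iff] at hl
  intro v w h
  funext i
  have := hl (v - w) (by
    funext x
    have hx := congrFun h x
    simp only [expand] at hx
    rw [← sub_eq_zero, ← Finset.sum_sub_distrib] at hx
    simpa [sub_mul, e] using hx) i
  simpa [sub_eq_zero] using this

theorem expand_add (v w : ZMod m → L) (x : K) :
    expand χ (v + w) x = expand χ v x + expand χ w x := by
  simp [expand, add_mul, Finset.sum_add_distrib]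

theorem expand_smul (c : L) (v : ZMod m → L) (x : K) :
    expand χ (fun i => c * v i) x = c * expand χ v x := by
  simp [expand, mul_assoc, Finset.mul_sum]

/-- A semilinear additive map acts on expansions by a shift of the coefficients. -/
theorem semilinear_expand (hadd : ∀ i j, χ (i + j) = χ i * χ j) (B : L →+ L) (d : ZMod m)
    (hB : ∀ (κ : K) (y : L), B (κ * y) = χ d κ * B y) (v : ZMod m → L) (x : K) :
    B (expand χ v x) = expand χ (fun i => B (v (i - d))) x := by
  simp only [expand, map_sum]
  rw [← Equiv.sum_comp (Equiv.addRight d) fun i => B (v (i - d)) * (χ i x : L)]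
  apply Finset.sum_congr rfl
  intro i _
  dsimp only [Equiv.coe_addRight]
  rw [mul_comm, hB, add_sub_cancel_right, add_comm i d, hadd, mul_comm]
  rfl

/-- The automorphisms are independent over `L` by Dedekind, and their number `[L : F]` equals the
`L`-dimension of the space of `F`-endomorphisms of `L`, so they form a basis. -/
theorem exists_algHom_expansion [FiniteDimensional F L] [IsGalois F L] (A : L →ₗ[F] L) :
    ∃ a : (L →ₐ[F] L) → L, ∀ y, A y = ∑ g, a g * g y := by
  have hl := linearIndependent_toLinearMap F L L
  have hc : Fintype.card (L →ₐ[F] L) = Module.finrank L (L →ₗ[F] L) := by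
    rw [Module.finrank_linearMap_self, ← IsGalois.card_aut_eq_finrank F L, ← Nat.card_eq_fintype_card]
    exact (Nat.card_congr (algEquivEquivAlgHom F L).toEquiv).symm
  have hs := hl.span_eq_top_of_card_eq_finrank' hc
  have hA : A ∈ Submodule.span L (Set.range (AlgHom.toLinearMap : (L →ₐ[F] L) → L →ₗ[F] L)) := by
    rw [hs]; trivial
  obtain ⟨a, ha⟩ := (Submodule.mem_span_range_iff_exists_fun L).1 hA
  refine ⟨a, fun y => ?_⟩
  rw [← ha]
  simp

/-- Every `F`-linear map is a sum of maps that are semilinear over `K`. -/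
theorem exists_semilinear_decomposition [FiniteDimensional F L] [IsGalois F L]
    (hres : ∀ g : L →ₐ[F] L, ∃ d, ∀ κ : K, g κ = χ d κ) (A : L →ₗ[F] L) :
    ∃ B : ZMod m → (L →+ L), (∀ y, A y = ∑ d, B d y) ∧
      ∀ (d : ZMod m) (κ : K) (y : L), B d (κ * y) = χ d κ * B d y := by
  obtain ⟨a, ha⟩ := exists_algHom_expansion A
  choose δ hδ using hres
  -- `B d` collects the terms whose automorphism restricts to `χ d` on `K`.
  refine ⟨fun d => ∑ g with δ g = d, (AddMonoidHom.mulLeft (a g)).comp (g : L →+ L), ?_, ?_⟩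
  · intro y
    rw [ha, ← Finset.sum_fiberwise univ δ]
    simp
  · intro d κ y
    simp only [AddMonoidHom.finsetSum_apply, Finset.mul_sum]
    apply Finset.sum_congr rfl
    intro g hg
    have hd := (Finset.mem_filter.1 hg).2
    subst hd
    simp [hδ]
    ring

/-- Linear maps thus act on coefficient vectors by a convolution over `ZMod m`, which makes
stability of a code a condition on supports. -/
theorem linear_expand (hadd : ∀ i j, χ (i + j) = χ i * χ j) (B : ZMod m → (L →+ L))
    (hB : ∀ (d : ZMod m) (κ : K) (y : L), B d (κ * y) = χ d κ * B d y)
    (v : ZMod m → L) (x : K) :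
    ∑ d, B d (expand χ v x) = expand χ (fun i => ∑ d, B d (v (i - d))) x := by
  simp_rw [semilinear_expand hadd (B _) _ (hB _), expand, Finset.sum_mul]
  rw [Finset.sum_comm]

end Expansion

/-! ### The coefficients of punctured twisted Gabidulin codes -/

section TwistedCoeffs

variable {F L : Type*} [Field F] [Field L] [Algebra F L] {K : IntermediateField F L}
  {m : ℕ} [NeZero m]

/-- The coefficient vectors supported in `{0, …, t}` whose last entry is the image of the first
under `N`. -/
def twistedCoeffs (m : ℕ) (t : ℕ) (N : L →+ L) : Set (ZMod m → L) :=
  {v | (∀ i : ZMod m, t < i.val → v i = 0) ∧ v (t : ZMod m) = N (v 0)}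

variable {χ : ZMod m → (K ≃ₐ[F] K)} {t : ℕ} {N : L →+ L}

omit [NeZero m] in
theorem eq_zero_of_mem_twistedCoeffs {v : ZMod m → L} (hv : v ∈ twistedCoeffs m t N) {i : ℕ}
    (h1 : t < i) (h2 : i < m) : v (i : ZMod m) = 0 :=
  hv.1 _ (by rwa [ZMod.val_natCast_of_lt h2])

-- These vectors and those coupling the positions `0` and `t` are the test vectors for linear maps
-- that preserve the code.
omit [NeZero m] in
theorem single_mem_twistedCoeffs {j : ℕ} (h0 : 0 < j) (hj : j < t) (ht : t < m) (c : L) :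
    Pi.single (j : ZMod m) c ∈ twistedCoeffs m t N := by
  have hjm : ((j : ℕ) : ZMod m).val = j := ZMod.val_natCast_of_lt (by omega)
  have htm : ((t : ℕ) : ZMod m).val = t := ZMod.val_natCast_of_lt ht
  constructor
  · intro i hi
    rw [Pi.single_eq_of_ne]
    rintro rfl
    omega
  · rw [Pi.single_eq_of_ne, Pi.single_eq_of_ne, map_zero]
    · intro h
      rw [← h, ZMod.val_zero] at hjm
      omega
    · intro h
      rw [← h] at hjm
      omega

omit [NeZero m] in
theorem single_add_single_mem_twistedCoeffs (h0 : 0 < t) (ht : t < m) (a : L) :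
    Pi.single (0 : ZMod m) a + Pi.single (t : ZMod m) (N a) ∈ twistedCoeffs m t N := by
  have htm : ((t : ℕ) : ZMod m).val = t := ZMod.val_natCast_of_lt ht
  have hne : (t : ZMod m) ≠ 0 := by
    intro h
    rw [h, ZMod.val_zero] at htm
    omega
  constructor
  · intro i hi
    have h1 : i ≠ 0 := by rintro rfl; simp at hi
    have h2 : i ≠ (t : ZMod m) := by rintro rfl; omega
    simp [h1, h2]
  · simp [hne, hne.symm]

omit [NeZero m] in
/-- Vectors in `twistedCoeffs` with prescribed values in two of the positions `0, …, t - 1`. -/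
theorem exists_mem_twistedCoeffs (ht : t < m) {r₁ r₂ : ℕ} (h₁ : r₁ < t) (h₂ : r₂ < t)
    (hr : r₁ ≠ r₂) (p₁ p₂ : L) :
    ∃ v ∈ twistedCoeffs m t N, v (r₁ : ZMod m) = p₁ ∧ v (r₂ : ZMod m) = p₂ := by
  have htm : ((t : ℕ) : ZMod m).val = t := ZMod.val_natCast_of_lt ht
  have h1m : ((r₁ : ℕ) : ZMod m).val = r₁ := ZMod.val_natCast_of_lt (by omega)
  have h2m : ((r₂ : ℕ) : ZMod m).val = r₂ := ZMod.val_natCast_of_lt (by omega)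
  have h1t : (r₁ : ZMod m) ≠ t := fun h => by rw [h] at h1m; omega
  have h2t : (r₂ : ZMod m) ≠ t := fun h => by rw [h] at h2m; omega
  have h21 : (r₂ : ZMod m) ≠ r₁ := fun h => by rw [h] at h2m; omega
  have h0t : (0 : ZMod m) ≠ t := fun h => by rw [← h, ZMod.val_zero] at htm; omega
  let w : ZMod m → L := Pi.single (r₁ : ZMod m) p₁ + Pi.single (r₂ : ZMod m) p₂
  refine ⟨Function.update w t (N (w 0)), ⟨?_, ?_⟩, ?_, ?_⟩
  · intro i hi
    have e0 : i ≠ t := by rintro rfl; omega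
    have e1 : i ≠ r₁ := by rintro rfl; omega
    have e2 : i ≠ r₂ := by rintro rfl; omega
    simp [w, e0, e1, e2]
  · simp [h0t]
  · simp [w, h1t, h21.symm]
  · simp [w, h2t, h21]

/-- A linear map that preserves a punctured twisted Gabidulin code is linear over `K`. -/
theorem semilinear_part_eq_zero (hadd : ∀ i j, χ (i + j) = χ i * χ j)
    (hinj : Function.Injective χ) (hN : Function.Bijective N) {e : ZMod m}
    (hNe : ∀ (κ : K) (y : L), N (κ * y) = χ e κ * N y)
    (h0 : 0 < t) (htm : t + 2 ≤ m) (he : e ≠ t)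
    (B : ZMod m → (L →+ L))
    (hB : ∀ (d : ZMod m) (κ : K) (y : L), B d (κ * y) = χ d κ * B d y)
    (hC : ∀ v ∈ twistedCoeffs m t N, (fun i => ∑ d, B d (v (i - d))) ∈ twistedCoeffs m t N)
    {d : ZMod m} (hd : d ≠ 0) : B d = 0 := by
  have hsep : ∀ i j : ZMod m, i ≠ j → ∃ κ : K, (χ i κ : L) ≠ χ j κ := by
    intro i j hij
    by_contra! h
    exact hij (hinj (AlgEquiv.ext fun κ => Subtype.ext (h κ)))
  -- the action on a vector with a single entry
  have hsingle : ∀ (j : ZMod m) (c : L) (r : ZMod m),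
      ∑ d, B d ((Pi.single j c : ZMod m → L) (r - d)) = B (r - j) c := by
    intro j c r
    rw [Finset.sum_eq_single (r - j)]
    · simp
    · intro b _ hb
      rw [Pi.single_eq_of_ne, map_zero]
      rintro h
      exact hb (by rw [← h]; ring)
    · simp
  have htv : ((t : ℕ) : ZMod m).val = t := ZMod.val_natCast_of_lt (by omega)
  -- the constraints from the entries outside `{0, …, t}` of the twisted vectors
  have htw : ∀ r : ZMod m, t < r.val → B r = 0 ∧ B (r - t) = 0 := by
    intro r hr
    have key : ∀ a : L, B r a + B (r - t) (N a) = 0 := by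
      intro a
      have h := (hC _ (single_add_single_mem_twistedCoeffs (N := N) h0 (by omega) a)).1 r hr
      simp only [Pi.add_apply, map_add, Finset.sum_add_distrib, hsingle, sub_zero] at h
      exact h
    -- The two terms of `key` are semilinear for `χ r` and `χ (r - t + e)`, which differ because `e
    -- ≠ t`. A sum of two such maps is zero only if both are.
    obtain ⟨κ, hκ⟩ := hsep r (r - t + e) (by
      intro h
      apply he
      have : (r - t + e) - r = 0 := by rw [← h]; ring
      have h2 : e - t = 0 := by rw [← this]; ring
      exact sub_eq_zero.1 h2)
    have hr0 : ∀ a, B r a = 0 := by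
      intro a
      have h1 := key (κ * a)
      rw [hNe, hB, hB] at h1
      have h3 : (χ (r - t) (χ e κ) : L) = χ (r - t + e) κ := by rw [hadd]; rfl
      rw [h3] at h1
      have h2 := key a
      have : ((χ r κ : L) - χ (r - t + e) κ) * B r a = 0 := by
        linear_combination h1 - (χ (r - t + e) κ : L) * h2
      rcases mul_eq_zero.1 this with h | h
      · exact absurd (sub_eq_zero.1 h) hκ
      · exact h
    refine ⟨AddMonoidHom.ext hr0, ?_⟩
    ext a
    obtain ⟨b, rfl⟩ := hN.2 a
    have := key b
    rwa [hr0, zero_add] at this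
  have hdv : ((d.val : ℕ) : ZMod m) = d := ZMod.natCast_zmod_val d
  have hdlt : d.val < m := ZMod.val_lt d
  have hd0 : d.val ≠ 0 := by rwa [Ne, ZMod.val_eq_zero]
  -- `htw` kills `B d` for `d > t` and for `0 < d < m - t`. What is left is `m - t ≤ d ≤ t`, where
  -- `2 ≤ t` is automatic.
  by_cases c1 : t < d.val
  · exact (htw d c1).1
  by_cases c2 : d.val + t < m
  · have hv : ((d.val + t : ℕ) : ZMod m).val = d.val + t := ZMod.val_natCast_of_lt c2
    have := (htw ((d.val + t : ℕ) : ZMod m) (by omega)).2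
    rwa [Nat.cast_add, hdv, add_sub_cancel_right] at this
  by_cases c3 : d.val = t
  · -- shift the entry at `1` out of the support
    ext c
    have hv : ((t + 1 : ℕ) : ZMod m).val = t + 1 := ZMod.val_natCast_of_lt (by omega)
    have h := (hC _ (single_mem_twistedCoeffs (N := N) (j := 1) one_pos (by omega)
      (by omega) c)).1 ((t + 1 : ℕ) : ZMod m) (by omega)
    simp only [hsingle] at h
    rwa [Nat.cast_add, add_sub_cancel_right, ← c3, hdv] at h
  · -- shift the entry at `t - d` to the position `t`
    have hj : 0 < t - d.val := by omega
    have key : ∀ c : L, B d c = N (B (-((t - d.val : ℕ) : ZMod m)) c) := by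
      intro c
      have h := (hC _ (single_mem_twistedCoeffs (N := N) hj (by omega) (by omega) c)).2
      simp only [hsingle] at h
      rw [zero_sub, Nat.cast_sub (by omega), hdv, sub_sub_cancel] at h
      rw [h, Nat.cast_sub (by omega), hdv]
    -- In `key` the left side has companion index `d` and the right side `e - (t - d)`. These agree
    -- only if `e = t`.
    have hm' : e + -((t - d.val : ℕ) : ZMod m) ≠ d := by
      rw [Nat.cast_sub (by omega), hdv]
      intro h
      apply he
      linear_combination h
    obtain ⟨κ, hκ⟩ := hsep _ _ hm'
    ext c
    have h1 := key (κ * c)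
    rw [hB, hB, hNe, ← key] at h1
    have h3 : (χ e (χ (-((t - d.val : ℕ) : ZMod m)) κ) : L)
        = χ (e + -((t - d.val : ℕ) : ZMod m)) κ := by rw [hadd]; rfl
    rw [h3] at h1
    have h4 : ((χ (e + -((t - d.val : ℕ) : ZMod m)) κ : L) - χ d κ) * B d c = 0 := by
      linear_combination -h1
    rcases mul_eq_zero.1 h4 with h | h
    · exact absurd (sub_eq_zero.1 h) hκ
    · exact h

/-- The common members of a punctured twisted Gabidulin code and of its image under a semilinear
bijection satisfy two independent linear conditions. -/
theorem exists_two_zeros (hN : Function.Injective N) (h2 : 2 ≤ t) (htm : t + 3 ≤ m)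
    {d : ZMod m} (hd : d ≠ 0) :
    ∃ r₁ r₂ : ℕ, r₁ < t ∧ r₂ < t ∧ r₁ ≠ r₂ ∧ ∀ (ρ : L →+ L) (w v : ZMod m → L),
      Function.Injective ρ →
      w ∈ twistedCoeffs m t N → v ∈ twistedCoeffs m t N → (w = fun i => ρ (v (i - d))) →
      w (r₁ : ZMod m) = 0 ∧ w (r₂ : ZMod m) = 0 := by
  have hdv : ((d.val : ℕ) : ZMod m) = d := ZMod.natCast_zmod_val d
  have hdlt : d.val < m := ZMod.val_lt d
  have hd0 : d.val ≠ 0 := by rwa [Ne, ZMod.val_eq_zero]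
  have rel : ∀ {ρ : L →+ L} {w v : ZMod m → L}, (w = fun i => ρ (v (i - d))) →
      ∀ e r : ℕ, (e + d.val = r ∨ e + d.val = r + m) → w (r : ZMod m) = ρ (v (e : ZMod m)) := by
    intro ρ w v h e r her
    have hr : (r : ZMod m) = e + d := by
      rw [← hdv, ← Nat.cast_add]
      rcases her with h | h <;> rw [h]
      simp
    rw [hr, h]
    simp
  have rel0 : ∀ {ρ : L →+ L} {w v : ZMod m → L}, v ∈ twistedCoeffs m t N →
      (w = fun i => ρ (v (i - d))) →
      ∀ e r : ℕ, (e + d.val = r ∨ e + d.val = r + m) → t < e → e < m → w (r : ZMod m) = 0 := by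
    intro ρ w v hv h e r her h1 h2
    rw [rel h e r her, eq_zero_of_mem_twistedCoeffs hv h1 h2, map_zero]
  have hzero : ∀ {w : ZMod m → L}, w ∈ twistedCoeffs m t N → w (t : ZMod m) = 0 →
      w ((0 : ℕ) : ZMod m) = 0 := by
    intro w hw h
    rw [hw.2] at h
    rw [Nat.cast_zero]
    exact hN (by rw [h, map_zero])
  have hzero' : ∀ {w : ZMod m → L}, w ∈ twistedCoeffs m t N → w ((0 : ℕ) : ZMod m) = 0 →
      w (t : ZMod m) = 0 := by
    intro w hw h
    rw [Nat.cast_zero] at h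
    rw [hw.2, h, map_zero]
  -- Entries of `w` coming from positions of `v` beyond `t` vanish. For `d = ±1` this yields only
  -- one usable zero. The second comes from a zero of `w` outside the support, which kills one end
  -- of `v` and hence, through `N`, the other.
  by_cases c1 : d.val = 1
  · refine ⟨0, 1, by omega, by omega, by omega, fun ρ w v hρ hw hv h => ⟨?_, ?_⟩⟩
    · exact rel0 hv h (m - 1) 0 (by omega) (by omega) (by omega)
    · have h1 := eq_zero_of_mem_twistedCoeffs hw (i := t + 1) (by omega) (by omega)
      rw [rel h t (t + 1) (by omega)] at h1
      rw [rel h 0 1 (by omega), hzero hv (hρ (by rw [h1, map_zero])), map_zero]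
  by_cases c2 : d.val = m - 1
  · refine ⟨0, t - 1, by omega, by omega, by omega, fun ρ w v hρ hw hv h => ⟨?_, ?_⟩⟩
    · exact hzero hw (rel0 hv h (t + 1) t (by omega) (by omega) (by omega))
    · have h1 := eq_zero_of_mem_twistedCoeffs hw (i := m - 1) (by omega) (by omega)
      rw [rel h 0 (m - 1) (by omega)] at h1
      rw [rel h t (t - 1) (by omega), hzero' hv (hρ (by rw [h1, map_zero])), map_zero]
  -- Since `t + 3 ≤ m`, both `m - 1` and `m - 2` lie beyond `t`. For `d > t`, the zero at `t` is
  -- moved to the free position `0` by injectivity of `N`.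
  by_cases c3 : d.val ≤ t
  · exact ⟨d.val - 1, d.val - 2, by omega, by omega, by omega, fun ρ w v hρ hw hv h =>
      ⟨rel0 hv h (m - 1) _ (by omega) (by omega) (by omega),
        rel0 hv h (m - 2) _ (by omega) (by omega) (by omega)⟩⟩
  · exact ⟨0, t - 1, by omega, by omega, by omega, fun ρ w v hρ hw hv h =>
      ⟨hzero hw (rel0 hv h (t + m - d.val) t (by omega) (by omega) (by omega)),
        rel0 hv h (t - 1 + m - d.val) (t - 1) (by omega) (by omega) (by omega)⟩⟩

end TwistedCoeffs
end RankMetric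

namespace RankMetric

open Finset

/-! ### The contradiction between twisted coefficients and linearized polynomials -/

section Core

variable {F L : Type*} [Field F] [Fintype F] [Field L] [Algebra F L] [FiniteDimensional F L]
  {K : IntermediateField F L} {m : ℕ} [NeZero m]

theorem frobeniusAlgEquivOfAlgebraic_pow_apply (j : ℕ) (y : L) :
    (FiniteField.frobeniusAlgEquivOfAlgebraic F L ^ j) y = y ^ Fintype.card F ^ j := by
  have := FiniteField.coe_frobeniusAlgEquivOfAlgebraic_iterate F L j
  rw [← AlgEquiv.coe_pow] at this
  rw [this]

/-- A punctured twisted Gabidulin code, given by its coefficients, is not the image of a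
generalized Gabidulin code under a semilinear bijection. -/
theorem twistedCoeffs_ne_gabidulin {χ : ZMod m → (K ≃ₐ[F] K)} {t : ℕ} {N : L →+ L}
    (hadd : ∀ i j, χ (i + j) = χ i * χ j) (hinj : Function.Injective χ)
    (hres : ∀ g : L →ₐ[F] L, ∃ d, ∀ κ : K, g κ = χ d κ)
    (hN : Function.Bijective N) {e : ZMod m}
    (hNe : ∀ (κ : K) (y : L), N (κ * y) = χ e κ * N y)
    (h0 : 0 < t) (htm : t + 2 ≤ m) (he : e ≠ t) (he0 : e = 0 → 2 ≤ t ∧ t + 3 ≤ m)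
    (σ : F ≃+* F) (A : L ≃+ L) (hA : ∀ (c : F) (y : L), A (c • y) = σ c • A y)
    (γ : K → L) (t' j : ℕ) {d : ZMod m} (hd : d ≠ 0)
    (hj : ∀ κ : K, (κ : L) ^ Fintype.card F ^ j = χ d κ)
    (H : ∀ f : K → L, (∃ v ∈ twistedCoeffs m t N, f = expand χ v) ↔
      ∃ a : Fin t' → L, ∀ x, f x = A (∑ h : Fin t', a h * γ x ^ Fintype.card F ^ (j * (h : ℕ)))) :
    False := by
  have : Finite L := Module.finite_of_finite F
  have hAs : ∀ (c : F) (y : L), A.symm (c • y) = σ.symm c • A.symm y := by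
    intro c y
    apply A.injective
    simp [hA]
  -- left multiplications, transported by `A`
  let θ : L → (L →ₗ[F] L) := fun l =>
    { toFun := fun y => A (l * A.symm y)
      map_add' := fun y z => by rw [map_add, mul_add, map_add]
      map_smul' := fun c y => by
        rw [hAs, mul_smul_comm, hA, RingEquiv.apply_symm_apply, RingHom.id_apply] }
  have hθ : ∀ l y, θ l y = A (l * A.symm y) := fun _ _ => rfl
  -- Multiplying all coefficients of a `q^j`-polynomial by `l` does not raise its degree.
  have hθC : ∀ l, ∀ v ∈ twistedCoeffs m t N, ∃ w ∈ twistedCoeffs m t N,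
      ∀ x, θ l (expand χ v x) = expand χ w x := by
    intro l v hv
    obtain ⟨a, ha⟩ := (H (expand χ v)).1 ⟨v, hv, rfl⟩
    obtain ⟨w, hw, hw'⟩ := (H (fun x => θ l (expand χ v x))).2 ⟨fun h => l * a h, fun x => by
      rw [hθ, ha, AddEquiv.symm_apply_apply, Finset.mul_sum]
      simp only [mul_assoc]⟩
    exact ⟨w, hw, fun x => congrFun hw' x⟩
  have hθK : ∀ (l : L) (κ : K) (y : L), θ l (κ * y) = κ * θ l y := by
    intro l
    obtain ⟨B, hB1, hB2⟩ := exists_semilinear_decomposition hres (θ l)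
    have hB0 : ∀ d : ZMod m, d ≠ 0 → B d = 0 := by
      intro d hd
      refine semilinear_part_eq_zero hadd hinj hN hNe h0 htm he B hB2 ?_ hd
      intro v hv
      obtain ⟨w, hw, hvw⟩ := hθC l v hv
      have hwB : w = fun i => ∑ d, B d (v (i - d)) := by
        apply expand_injective hinj
        funext x
        rw [← hvw, hB1, linear_expand hadd B hB2]
      rwa [← hwB]
    have hχ0 : χ 0 = 1 := by
      have := hadd 0 0
      rw [add_zero] at this
      exact (left_eq_mul.1 this)
    have hB : ∀ y, θ l y = B 0 y := by
      intro y
      rw [hB1, Finset.sum_eq_single 0]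
      · intro d _ hd
        rw [hB0 d hd]; rfl
      · simp
    intro κ y
    rw [hB, hB, hB2, hχ0]
    rfl
  -- multiplication by `K` is among the transported multiplications
  have hKθ : ∀ κ : K, ∃ l, ∀ y, θ l y = κ * y := by
    intro κ
    refine ⟨A.symm (κ * A 1), fun y => ?_⟩
    -- Commutativity of `L` exchanges the roles of `A⁻¹ y` and `A⁻¹ (κ * A 1)`, turning
    -- `K`-linearity of one transported multiplication into a formula for another.
    have h := hθK (A.symm y) κ (A 1)
    rw [hθ, hθ, AddEquiv.symm_apply_apply, mul_one, AddEquiv.apply_symm_apply] at h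
    rw [← h, hθ, mul_comm]
  have hχ0 : χ 0 = 1 := by
    have := hadd 0 0
    rw [add_zero] at this
    exact (left_eq_mul.1 this)
  have he' : e = 0 := by
    apply hinj
    rw [hχ0]
    ext κ
    obtain ⟨l, hl⟩ := hKθ κ
    obtain ⟨w, hw, hvw⟩ := hθC l _ (single_add_single_mem_twistedCoeffs (N := N) h0 (by omega) 1)
    set v := (Pi.single (0 : ZMod m) (1 : L) + Pi.single (t : ZMod m) (N 1) : ZMod m → L) with hv
    have hvm : v ∈ twistedCoeffs m t N := single_add_single_mem_twistedCoeffs h0 (by omega) 1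
    have hwv : w = fun i => (κ : L) * v i := by
      apply expand_injective hinj
      funext x
      rw [expand_smul, ← hl, hvw]
    -- Both `v` and `κ v` satisfy the relation between the entries `0` and `t`, so `χ e κ = κ`.
    have h1 := hw.2
    rw [hwv] at h1
    simp only [] at h1
    rw [hNe, hvm.2] at h1
    have h2 : v 0 ≠ 0 := by
      have : (0 : ZMod m) ≠ t := by
        intro h
        have := congrArg ZMod.val h
        rw [ZMod.val_natCast_of_lt (by omega), ZMod.val_zero] at this
        omega
      simp [hv, this]
    have h3 : N (v 0) ≠ 0 := fun h => h2 (hN.1 (by rw [h, map_zero]))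
    exact (mul_right_cancel₀ h3 h1).symm
  obtain ⟨h2t, htm3⟩ := he0 he'
  -- the transported Frobenius map
  let φ := FiniteField.frobeniusAlgEquivOfAlgebraic F L ^ j
  have hφ : ∀ y, φ y = y ^ Fintype.card F ^ j := frobeniusAlgEquivOfAlgebraic_pow_apply j
  let ρ : L →+ L := (A : L →+ L).comp ((φ : L →+ L).comp (A.symm : L →+ L))
  have hρ : ∀ y, ρ y = A (φ (A.symm y)) := fun _ => rfl
  have hρinj : Function.Injective ρ := A.injective.comp (φ.injective.comp A.symm.injective)
  have hρd : ∀ (κ : K) (y : L), ρ (κ * y) = χ d κ * ρ y := by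
    intro κ y
    obtain ⟨l, hl⟩ := hKθ κ
    -- `A` intertwines multiplication by `l` with multiplication by `κ`, hence also their powers.
    -- The power `q^j` gives the semilinearity of `ρ`.
    have hpow : ∀ (i : ℕ) (y : L), A (l ^ i * A.symm y) = (κ : L) ^ i * y := by
      intro i
      induction i with
      | zero => intro y; simp
      | succ i ih =>
        intro y
        have := ih (θ l y)
        rw [hl, ← mul_assoc, ← pow_succ] at this
        rw [← this, ← hl, hθ, AddEquiv.symm_apply_apply, ← mul_assoc, pow_succ]
    rw [← hl, hρ, hθ, AddEquiv.symm_apply_apply, map_mul, hφ l]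
    have := hpow (Fintype.card F ^ j) (ρ y)
    rw [hρ, AddEquiv.symm_apply_apply] at this
    rw [this, hj, hρ]
  obtain ⟨r₁, r₂, hr1, hr2, hr12, hzero⟩ := exists_two_zeros (m := m) hN.1 h2t htm3 hd
  -- a single transported line together with the intersection spans the code
  have hsurj : ∃ Φ : L → L × L, Function.Surjective Φ := by
    -- With no coefficients available the code would be zero, but it contains a nonzero vector.
    rcases t' with _ | t'
    · exfalso
      obtain ⟨a, ha⟩ := (H (expand χ (Pi.single 0 1 + Pi.single (t : ZMod m) (N 1)))).1
        ⟨_, single_add_single_mem_twistedCoeffs h0 (by omega) 1, rfl⟩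
      have hz : (Pi.single (0 : ZMod m) (1 : L) + Pi.single (t : ZMod m) (N 1) : ZMod m → L) = 0 := by
        apply expand_injective hinj
        funext x
        rw [ha]
        simp [expand]
      have h := congrFun hz 0
      have : (0 : ZMod m) ≠ t := by
        intro h
        have := congrArg ZMod.val h
        rw [ZMod.val_natCast_of_lt (by omega), ZMod.val_zero] at this
        omega
      simp [this] at h
    have hline : ∀ l, ∃ g ∈ twistedCoeffs m t N, ∀ x, A (l * γ x) = expand χ g x := by
      intro l
      obtain ⟨g, hg, hg'⟩ := (H fun x => A (l * γ x)).2 ⟨Fin.cons l 0, fun x => by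
        simp [Fin.sum_univ_succ]⟩
      exact ⟨g, hg, fun x => congrFun hg' x⟩
    choose g hg hgx using hline
    refine ⟨fun l => (g l r₁, g l r₂), ?_⟩
    rintro ⟨p₁, p₂⟩
    obtain ⟨v, hv, hv1, hv2⟩ := exists_mem_twistedCoeffs (m := m) (N := N)
      (by omega : t < m) hr1 hr2 hr12 p₁ p₂
    obtain ⟨a, ha⟩ := (H (expand χ v)).1 ⟨v, hv, rfl⟩
    -- `w` is the member without its lowest term. It equals `ρ` of the member `u`, obtained by
    -- lowering every Frobenius exponent by `j` and applying `φ⁻¹` to the coefficients.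
    obtain ⟨w, hw, hw'⟩ := (H fun x => A (∑ h : Fin t', a h.succ *
      γ x ^ Fintype.card F ^ (j * ((h : ℕ) + 1)))).2 ⟨Fin.cons 0 (Fin.tail a), fun x => by
        simp [Fin.sum_univ_succ, Fin.tail]⟩
    obtain ⟨u, hu, hu'⟩ := (H fun x => A (∑ h : Fin t', φ.symm (a h.succ) *
      γ x ^ Fintype.card F ^ (j * (h : ℕ)))).2 ⟨Fin.snoc (fun h => φ.symm (a h.succ)) 0, fun x => by
        simp [Fin.sum_univ_castSucc]⟩
    have hvw : v = g (a 0) + w := by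
      apply expand_injective hinj
      funext x
      rw [expand_add, ← hgx, ha, ← congrFun hw' x, ← map_add, Fin.sum_univ_succ]
      simp
    have hwu : w = fun i => ρ (u (i - d)) := by
      apply expand_injective hinj
      funext x
      rw [← semilinear_expand hadd ρ d hρd, ← congrFun hw' x, ← congrFun hu' x, hρ,
        AddEquiv.symm_apply_apply, map_sum φ]
      congr 1
      apply Finset.sum_congr rfl
      intro h _
      rw [map_mul, AlgEquiv.apply_symm_apply, map_pow, hφ, ← pow_mul, ← pow_add]
      congr 3
      ring
    obtain ⟨hw1, hw2⟩ := hzero ρ w u hρinj hw hu hwu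
    refine ⟨a 0, ?_⟩
    rw [← hv1, ← hv2, hvw]
    simp [hw1, hw2]
  obtain ⟨Φ, hΦ⟩ := hsurj
  have h1 := Nat.card_le_card_of_surjective Φ hΦ
  rw [Nat.card_prod] at h1
  have h2 : 1 < Nat.card L := Finite.one_lt_card
  nlinarith

end Core
end RankMetric

namespace RankMetric

/-! ### Rank-preserving maps on bilinear forms -/

section RankOne

variable {F V V' : Type*} [Field F] [AddCommGroup V] [Module F V] [AddCommGroup V'] [Module F V']

/-- The form `(x, x') ↦ ξ x * ω x'`. -/
def tens (ξ : V →ₗ[F] F) (ω : V' →ₗ[F] F) : V →ₗ[F] V' →ₗ[F] F := ξ.smulRight ω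

@[simp]
theorem tens_apply (ξ : V →ₗ[F] F) (ω : V' →ₗ[F] F) (x : V) (x' : V') :
    tens ξ ω x x' = ξ x * ω x' := by
  simp [tens]

theorem tens_ne_zero {ξ : V →ₗ[F] F} {ω : V' →ₗ[F] F} (hξ : ξ ≠ 0) (hω : ω ≠ 0) :
    tens ξ ω ≠ 0 := by
  obtain ⟨x, hx⟩ := DFunLike.ne_iff.1 hξ
  obtain ⟨y, hy⟩ := DFunLike.ne_iff.1 hω
  intro h
  have := congrArg (fun f => f x y) h
  simp at this hx hy
  tauto

theorem formRank_eq_finrank_range [FiniteDimensional F V] (f : V →ₗ[F] V' →ₗ[F] F) :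
    formRank f = Module.finrank F (LinearMap.range f) := by
  have := LinearMap.finrank_range_add_finrank_ker f
  unfold formRank
  omega

theorem formRank_tens_le_one [FiniteDimensional F V] (ξ : V →ₗ[F] F) (ω : V' →ₗ[F] F) :
    formRank (tens ξ ω) ≤ 1 := by
  rw [formRank_eq_finrank_range]
  refine le_trans (Submodule.finrank_mono (t := Submodule.span F {ω}) ?_) ?_
  · rintro _ ⟨x, rfl⟩
    exact Submodule.mem_span_singleton.2 ⟨ξ x, by simp [tens]⟩
  · exact (finrank_span_le_card _).trans (by simp)

omit [AddCommGroup V'] [Module F V'] in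
theorem exists_generator_of_finrank_le_one (S : Submodule F V) [FiniteDimensional F S]
    (hS : Module.finrank F S ≤ 1) : ∃ w, ∀ v ∈ S, ∃ c : F, c • w = v := by
  obtain ⟨w, hw⟩ := finrank_le_one_iff.1 hS
  refine ⟨w, fun v hv => ?_⟩
  obtain ⟨c, hc⟩ := hw ⟨v, hv⟩
  exact ⟨c, congrArg Subtype.val hc⟩

theorem exists_eq_tens_of_formRank_le_one [FiniteDimensional F V] {f : V →ₗ[F] V' →ₗ[F] F}
    (hf : formRank f ≤ 1) : ∃ ξ ω, f = tens ξ ω := by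
  rw [formRank_eq_finrank_range] at hf
  obtain ⟨ω, h⟩ := exists_generator_of_finrank_le_one _ hf
  have h' : ∀ x, ∃ c : F, c • ω = f x := fun x => h _ (LinearMap.mem_range_self f x)
  by_cases h0 : ω = 0
  · refine ⟨0, 0, ?_⟩
    ext x x'
    obtain ⟨c, hc⟩ := h' x
    simp [← hc, h0]
  · obtain ⟨y, hy⟩ := DFunLike.ne_iff.1 h0
    refine ⟨(ω y)⁻¹ • (LinearMap.applyₗ y).comp f, ω, ?_⟩
    ext x x'
    obtain ⟨c, hc⟩ := h' x
    simp at hy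
    simp only [← hc, tens_apply, LinearMap.smul_apply, LinearMap.comp_apply,
      LinearMap.applyₗ_apply_apply, smul_eq_mul]
    field_simp

theorem exists_smul_of_ker_le {ξ ζ : V →ₗ[F] F} (h : ∀ x, ξ x = 0 → ζ x = 0) :
    ∃ c : F, ζ = c • ξ := by
  by_cases hξ : ξ = 0
  · exact ⟨0, by ext x; simpa using h x (by simp [hξ])⟩
  · obtain ⟨y, hy⟩ := DFunLike.ne_iff.1 hξ
    simp at hy
    refine ⟨ζ y * (ξ y)⁻¹, ?_⟩
    ext x
    have := h (x - (ξ x * (ξ y)⁻¹) • y) (by simp [hy])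
    simp at this
    simp
    linear_combination this

/-- If a sum of two products is a product then the left or the right factors are proportional. -/
theorem proportional_of_tens_add {ξ₁ ξ₂ ξ₃ : V →ₗ[F] F} {ω₁ ω₂ ω₃ : V' →ₗ[F] F}
    (h : tens ξ₁ ω₁ + tens ξ₂ ω₂ = tens ξ₃ ω₃) (hξ : ξ₁ ≠ 0)
    (hω : ω₂ ≠ 0) : (∃ c : F, ξ₂ = c • ξ₁) ∨ ∃ c : F, ω₁ = c • ω₂ := by
  by_cases hk : ∀ x, ξ₁ x = 0 → ξ₂ x = 0
  · exact Or.inl (exists_smul_of_ker_le hk)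
  right
  push Not at hk
  obtain ⟨x, hx1, hx2⟩ := hk
  have hap : ∀ x x', ξ₁ x * ω₁ x' + ξ₂ x * ω₂ x' = ξ₃ x * ω₃ x' := by
    intro x x'
    simpa using congrArg (fun f => f x x') h
  have h3 : ξ₃ x ≠ 0 := by
    intro h3
    apply hω
    ext x'
    have := hap x x'
    rw [hx1, h3, zero_mul, zero_mul, zero_add] at this
    simpa [hx2] using this
  -- Evaluation at `x` makes `ω₃` a multiple of `ω₂`, and evaluation at `y` then does the same for
  -- `ω₁`.
  obtain ⟨y, hy⟩ := DFunLike.ne_iff.1 hξ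
  rw [LinearMap.zero_apply] at hy
  refine ⟨(ξ₁ y)⁻¹ * (ξ₃ y * (ξ₃ x)⁻¹ * ξ₂ x - ξ₂ y), ?_⟩
  ext x'
  have e1 := hap x x'
  have e2 := hap y x'
  rw [hx1, zero_mul, zero_add] at e1
  rw [LinearMap.smul_apply, smul_eq_mul]
  field_simp
  linear_combination (ξ₃ x) * e2 - ξ₃ y * e1

theorem tens_add_right (ξ : V →ₗ[F] F) (ω ω' : V' →ₗ[F] F) :
    tens ξ (ω + ω') = tens ξ ω + tens ξ ω' := by
  ext; simp [mul_add]

theorem tens_add_left (ξ ξ' : V →ₗ[F] F) (ω : V' →ₗ[F] F) :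
    tens (ξ + ξ') ω = tens ξ ω + tens ξ' ω := by
  ext; simp [add_mul]

theorem tens_smul_right (c : F) (ξ : V →ₗ[F] F) (ω : V' →ₗ[F] F) :
    tens ξ (c • ω) = c • tens ξ ω := by
  ext; simp; ring

theorem tens_smul_left (c : F) (ξ : V →ₗ[F] F) (ω : V' →ₗ[F] F) :
    tens (c • ξ) ω = c • tens ξ ω := by
  ext; simp; ring

theorem tens_zero_right (ξ : V →ₗ[F] F) : tens ξ (0 : V' →ₗ[F] F) = 0 := by
  ext; simp

theorem tens_zero_left (ω : V' →ₗ[F] F) : tens (0 : V →ₗ[F] F) ω = 0 := by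
  ext; simp

theorem exists_smul_of_tens_eq {ξ ξ' : V →ₗ[F] F} {ω ω' : V' →ₗ[F] F} (hξ : ξ ≠ 0)
    (h : tens ξ ω = tens ξ' ω') : ∃ c : F, ω = c • ω' := by
  obtain ⟨y, hy⟩ := DFunLike.ne_iff.1 hξ
  rw [LinearMap.zero_apply] at hy
  refine ⟨(ξ y)⁻¹ * ξ' y, ?_⟩
  ext x'
  have : ξ y * ω x' = ξ' y * ω' x' := by simpa using congrArg (fun f => f y x') h
  rw [LinearMap.smul_apply, smul_eq_mul]
  field_simp
  linear_combination this

theorem tens_flip (ξ : V →ₗ[F] F) (ω : V' →ₗ[F] F) : (tens ξ ω).flip = tens ω ξ := by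
  ext; simp [mul_comm]

theorem tens_right_injective {ξ : V →ₗ[F] F} (hξ : ξ ≠ 0) :
    Function.Injective fun ω : V' →ₗ[F] F => tens ξ ω := by
  obtain ⟨y, hy⟩ := DFunLike.ne_iff.1 hξ
  rw [LinearMap.zero_apply] at hy
  intro ω ω' h
  ext x'
  have : ξ y * ω x' = ξ y * ω' x' := by simpa using congrArg (fun f => f y x') h
  exact mul_left_cancel₀ hy this

theorem tens_left_injective {ω : V' →ₗ[F] F} (hω : ω ≠ 0) :
    Function.Injective fun ξ : V →ₗ[F] F => tens ξ ω := by
  intro ξ ξ' h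
  apply tens_right_injective (V' := V) hω
  have := congrArg LinearMap.flip h
  simpa only [tens_flip] using this

theorem exists_smul_of_tens_eq' {ξ ξ' : V →ₗ[F] F} {ω ω' : V' →ₗ[F] F} (hω : ω ≠ 0)
    (h : tens ξ ω = tens ξ' ω') : ∃ c : F, ξ = c • ξ' := by
  have := congrArg LinearMap.flip h
  rw [tens_flip, tens_flip] at this
  exact exists_smul_of_tens_eq hω this

/-- An additive family of products has a common left or a common right factor. -/
theorem exists_common_factor {X : Type*} [AddCommGroup X] (b : X →+ (V →ₗ[F] V' →ₗ[F] F))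
    (hb : ∀ x, ∃ ξ ω, b x = tens ξ ω) (hne : ∃ x, b x ≠ 0) :
    (∃ ξ, ξ ≠ 0 ∧ ∀ x, ∃ ω, b x = tens ξ ω) ∨ ∃ ω, ω ≠ 0 ∧ ∀ x, ∃ ξ, b x = tens ξ ω := by
  choose ξ ω h using hb
  obtain ⟨x₀, hx₀⟩ := hne
  have hξ : ∀ x, b x ≠ 0 → ξ x ≠ 0 := fun x hx h0 => hx (by rw [h, h0, tens_zero_left])
  have hω : ∀ x, b x ≠ 0 → ω x ≠ 0 := fun x hx h0 => hx (by rw [h, h0, tens_zero_right])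
  have hprop : ∀ x y, b x ≠ 0 → b y ≠ 0 → (∃ c : F, ξ y = c • ξ x) ∨ ∃ c : F, ω x = c • ω y := by
    intro x y hx hy
    exact proportional_of_tens_add (ξ₃ := ξ (x + y)) (ω₃ := ω (x + y))
      (by rw [← h, ← h, ← h, map_add]) (hξ x hx) (hω y hy)
  by_cases hall : ∀ x, ∃ ω, b x = tens (ξ x₀) ω
  · exact Or.inl ⟨ξ x₀, hξ _ hx₀, hall⟩
  right
  push Not at hall
  obtain ⟨x₁, hx₁⟩ := hall
  have hb1 : b x₁ ≠ 0 := fun h0 => hx₁ 0 (by rw [h0, tens_zero_right])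
  have hnp : ¬ ∃ c : F, ξ x₁ = c • ξ x₀ := by
    rintro ⟨c, hc⟩
    apply hx₁ (c • ω x₁)
    rw [h, hc, tens_smul_left, tens_smul_right]
  obtain ⟨c, hc⟩ := (hprop x₀ x₁ hx₀ hb1).resolve_left hnp
  have key : ∀ x, (∃ c : F, ω x₁ = c • ω x) → ∃ ζ, b x = tens ζ (ω x₁) := by
    rintro x ⟨a, ha⟩
    have ha0 : a ≠ 0 := by
      rintro rfl
      exact hω _ hb1 (by rw [ha, zero_smul])
    refine ⟨a⁻¹ • ξ x, ?_⟩
    rw [ha, tens_smul_left, tens_smul_right, smul_smul, inv_mul_cancel₀ ha0, one_smul, h]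
  refine ⟨ω x₁, hω _ hb1, fun x => ?_⟩
  by_cases hx : b x = 0
  · exact ⟨0, by rw [hx, tens_zero_left]⟩
  -- A nonzero left factor cannot be proportional to both `ξ x₀` and `ξ x₁`, so the right factor of
  -- `b x` is proportional to that of `x₀` or of `x₁`, and these two are proportional.
  rcases hprop x₀ x hx₀ hx with ⟨a, ha⟩ | ⟨a, ha⟩
  · rcases hprop x₁ x hb1 hx with ⟨a', ha'⟩ | h'
    · exfalso
      have ha0 : a' ≠ 0 := by
        rintro rfl
        exact hξ _ hx (by rw [ha', zero_smul])
      apply hnp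
      refine ⟨a'⁻¹ * a, ?_⟩
      rw [mul_smul, ← ha, ha', smul_smul, inv_mul_cancel₀ ha0, one_smul]
    · exact key x h'
  · have hc0 : c ≠ 0 := by
      rintro rfl
      exact hω _ hx₀ (by rw [hc, zero_smul])
    apply key x
    refine ⟨c⁻¹ * a, ?_⟩
    rw [mul_smul, ← ha, hc, smul_smul, inv_mul_cancel₀ hc0, one_smul]

/-- A biadditive semilinear family of products whose right factor depends only on the second
argument is a product of semilinear maps. -/
theorem exists_factorization {X Y : Type*} [AddCommGroup X] [Module F X] [AddCommGroup Y]
    [Module F Y] [Nontrivial X] [Nontrivial Y] (σ : F ≃+* F)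
    (b : X → Y → (V →ₗ[F] V' →ₗ[F] F))
    (hadd : ∀ x x' y, b (x + x') y = b x y + b x' y)
    (hadd' : ∀ x y y', b x (y + y') = b x y + b x y')
    (hsmul : ∀ (c : F) x y, b (c • x) y = σ c • b x y)
    (hsmul' : ∀ (c : F) x y, b x (c • y) = σ c • b x y)
    (h1 : ∀ y, y ≠ 0 → ∃ q, q ≠ 0 ∧ (∀ x, ∃ p, b x y = tens p q) ∧ ∀ p, ∃ x, b x y = tens p q)
    (h0 : ∀ x y, b x y = 0 → x = 0 ∨ y = 0)
    (hind : ∀ x x' y y', b x y = b x' y' → b x y ≠ 0 → ∃ c : F, y' = c • y) :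
    ∃ (A : X →+ (V →ₗ[F] F)) (β : Y →+ (V' →ₗ[F] F)),
      (∀ (c : F) x, A (c • x) = σ c • A x) ∧ (∀ (c : F) y, β (c • y) = σ c • β y) ∧
      ∀ x y, b x y = tens (A x) (β y) := by
  obtain ⟨x₀, hx₀⟩ := exists_ne (0 : X)
  obtain ⟨y₀, hy₀⟩ := exists_ne (0 : Y)
  have hb0 : ∀ x y, x ≠ 0 → y ≠ 0 → b x y ≠ 0 := fun x y hx hy h => by
    rcases h0 x y h with h | h <;> tauto
  have hby0 : ∀ x, b x 0 = 0 := fun x => by simpa using hsmul' 0 x 0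
  obtain ⟨q₀, hq₀, hq₀1, hq₀2⟩ := h1 y₀ hy₀
  obtain ⟨P₀, hP₀⟩ := hq₀1 x₀
  have hP₀0 : P₀ ≠ 0 := fun h => hb0 _ _ hx₀ hy₀ (by rw [hP₀, h, tens_zero_left])
  -- the values at `x₀` have the common left factor `P₀`
  have hβ : ∀ y, ∃ β, b x₀ y = tens P₀ β := by
    intro y
    by_cases hy : ∃ c : F, y = c • y₀
    · obtain ⟨c, rfl⟩ := hy
      exact ⟨σ c • q₀, by rw [hsmul', hP₀, tens_smul_right]⟩
    have hy0 : y ≠ 0 := fun h => hy ⟨0, by rw [h, zero_smul]⟩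
    have hyy : y₀ + y ≠ 0 := fun h => hy ⟨-1, by
      rw [neg_one_smul]; exact (neg_eq_of_add_eq_zero_right h).symm⟩
    obtain ⟨q, hq, hq1, hq2⟩ := h1 y hy0
    obtain ⟨p, hp⟩ := hq1 x₀
    obtain ⟨q', hq', hq1', -⟩ := h1 _ hyy
    obtain ⟨p', hp'⟩ := hq1' x₀
    have hsum : tens P₀ q₀ + tens p q = tens p' q' := by rw [← hP₀, ← hp, ← hadd', hp']
    rcases proportional_of_tens_add hsum hP₀0 hq with ⟨c, hc⟩ | ⟨c, hc⟩
    · exact ⟨c • q, by rw [hp, hc, tens_smul_left, tens_smul_right]⟩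
    · exfalso
      apply hy
      obtain ⟨x', hx'⟩ := hq2 (c • P₀)
      exact hind x₀ x' y₀ y (by rw [hP₀, hx', hc, tens_smul_left, tens_smul_right])
        (hb0 _ _ hx₀ hy₀)
  choose β hβ using hβ
  have hβinj := tens_right_injective (V' := V') hP₀0
  let β' : Y →+ (V' →ₗ[F] F) :=
    { toFun := β
      map_zero' := hβinj (by dsimp only; rw [← hβ, hby0, tens_zero_right])
      map_add' := fun y y' => hβinj (by
        dsimp only; rw [← hβ, hadd', tens_add_right, hβ, hβ]) }
  have hβ' : ∀ y, b x₀ y = tens P₀ (β' y) := hβ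
  have hβs : ∀ (c : F) y, β' (c • y) = σ c • β' y := fun c y => hβinj (by
    dsimp only; rw [← hβ', hsmul', tens_smul_right, hβ'])
  have hβ0 : ∀ y, y ≠ 0 → β' y ≠ 0 := fun y hy h =>
    hb0 _ _ hx₀ hy (by rw [hβ', h, tens_zero_right])
  have hβi : ∀ y y' (c : F), y ≠ 0 → β' y' = c • β' y → ∃ c : F, y' = c • y := by
    intro y y' c hy h
    by_cases hy' : y' = 0
    · exact ⟨0, by rw [hy', zero_smul]⟩
    have hc : c ≠ 0 := by
      rintro rfl
      exact hβ0 _ hy' (by rw [h, zero_smul])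
    have hc' : σ.symm c ≠ 0 := by simpa using hc
    refine hind (σ.symm c • x₀) x₀ y y' ?_ (hb0 _ _ (smul_ne_zero hc' hx₀) hy)
    rw [hsmul, hβ', hβ', h, tens_smul_right, RingEquiv.apply_symm_apply]
  have hP : ∀ x y, ∃ P, b x y = tens P (β' y) := by
    intro x y
    by_cases hy : y = 0
    · exact ⟨0, by rw [hy, hby0, tens_zero_left]⟩
    obtain ⟨q, hq, hq1, -⟩ := h1 y hy
    obtain ⟨p₀, hp₀⟩ := hq1 x₀
    obtain ⟨p, hp⟩ := hq1 x
    have hp₀0 : p₀ ≠ 0 := fun h => hb0 _ _ hx₀ hy (by rw [hp₀, h, tens_zero_left])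
    obtain ⟨c, hc⟩ := exists_smul_of_tens_eq hp₀0 (hp₀.symm.trans (hβ' y))
    exact ⟨c • p, by rw [hp, hc, tens_smul_left, tens_smul_right]⟩
  choose P hP using hP
  have hall : ∀ x y, b x y = tens (P x y₀) (β' y) := by
    intro x y
    by_cases hy : ∃ c : F, y = c • y₀
    · obtain ⟨c, rfl⟩ := hy
      rw [hsmul', hP, hβs, tens_smul_right]
    have hnn : ∃ n, β' y n = 0 ∧ β' y₀ n ≠ 0 := by
      by_contra! hcon
      obtain ⟨c, hc⟩ := exists_smul_of_ker_le hcon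
      have hy0 : y ≠ 0 := fun h => hy ⟨0, by rw [h, zero_smul]⟩
      obtain ⟨a, ha⟩ := hβi y y₀ c hy0 hc
      have ha0 : a ≠ 0 := by
        rintro rfl
        exact hy₀ (by rw [ha, zero_smul])
      exact hy ⟨a⁻¹, by rw [ha, smul_smul, inv_mul_cancel₀ ha0, one_smul]⟩
    have hnn' : ∃ n, β' y₀ n = 0 ∧ β' y n ≠ 0 := by
      by_contra! hcon
      obtain ⟨c, hc⟩ := exists_smul_of_ker_le hcon
      exact hy (hβi y₀ y c hy₀ hc)
    -- As `β' y` and `β' y₀` are independent, they can be separated by evaluation, which gives `P x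
    -- y = P x (y + y₀) = P x y₀`.
    have hs : ∀ v n, P x (y + y₀) v * (β' y n + β' y₀ n)
        = P x y v * β' y n + P x y₀ v * β' y₀ n := by
      intro v n
      have := hadd' x y y₀
      rw [hP, hP x y, hP x y₀, map_add] at this
      simpa using congrArg (fun f => f v n) this
    obtain ⟨n, hn, hn'⟩ := hnn
    obtain ⟨l, hl, hl'⟩ := hnn'
    have e : P x y = P x y₀ := by
      ext v
      have e1 := hs v n
      have e2 := hs v l
      rw [hn, zero_add, mul_zero, zero_add] at e1
      rw [hl, add_zero, mul_zero, add_zero] at e2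
      rw [← mul_right_cancel₀ hn' e1, mul_right_cancel₀ hl' e2]
    rw [hP, e]
  have hAinj := tens_left_injective (V := V) (hβ0 _ hy₀)
  refine ⟨{ toFun := fun x => P x y₀, map_zero' := hAinj ?_, map_add' := fun x x' => hAinj ?_ }, β',
    fun c x => hAinj ?_, hβs, fun x y => hall x y⟩
  · dsimp only
    rw [← hP, tens_zero_left]
    simpa using hsmul 0 0 y₀
  · dsimp only
    rw [← hP, hadd, tens_add_left, hP, hP]
  · dsimp
    rw [← hP, hsmul, tens_smul_left, hP]

/-- It reduces a semilinear map on forms to its values on forms of rank at most one. -/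
theorem eq_sum_tens {m : ℕ} (b : Module.Basis (Fin m) F V) (f : V →ₗ[F] V' →ₗ[F] F) :
    f = ∑ i, tens (b.coord i) (f (b i)) := by
  apply b.ext
  intro i
  ext x'
  simp only [LinearMap.sum_apply, tens_apply, Module.Basis.coord_apply, Module.Basis.repr_self]
  rw [Finset.sum_eq_single i]
  · simp
  · intro c _ hc
    simp [hc.symm]
  · simp

end RankOne
end RankMetric

namespace RankMetric

/-! ### Rank preservers act on the tensor factors -/

section Classification

variable {F V V' : Type*} [Field F] [Finite F] [AddCommGroup V] [Module F V] [AddCommGroup V']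
  [Module F V'] [FiniteDimensional F V] [FiniteDimensional F V']

/-- A semilinear bijection that preserves the rank is, on forms of rank one, induced by semilinear
maps of the factors, possibly after exchanging them. -/
theorem rank_preserver_classification [Nontrivial V]
    (hdim : Module.finrank F V ≤ Module.finrank F V') (σ : F ≃+* F)
    (ψ : (V →ₗ[F] V' →ₗ[F] F) ≃+ (V →ₗ[F] V' →ₗ[F] F))
    (hψ : ∀ (c : F) f, ψ (c • f) = σ c • ψ f) (hrank : ∀ f, formRank (ψ f) = formRank f) :
    (∃ (A : (V' →ₗ[F] F) →+ (V' →ₗ[F] F)) (β : (V →ₗ[F] F) →+ (V →ₗ[F] F)),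
      (∀ (c : F) x, A (c • x) = σ c • A x) ∧ (∀ (c : F) y, β (c • y) = σ c • β y) ∧
      ∀ ξ ω, ψ (tens ξ ω) = tens (β ξ) (A ω)) ∨
    (Module.finrank F V = Module.finrank F V' ∧
      ∃ (A : (V' →ₗ[F] F) →+ (V →ₗ[F] F)) (β : (V →ₗ[F] F) →+ (V' →ₗ[F] F)),
      (∀ (c : F) x, A (c • x) = σ c • A x) ∧ (∀ (c : F) y, β (c • y) = σ c • β y) ∧
      ∀ ξ ω, ψ (tens ξ ω) = tens (A ω) (β ξ)) := by
  have hV : 0 < Module.finrank F V := Module.finrank_pos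
  have hV' : 0 < Module.finrank F V' := by omega
  have : Nontrivial V' := Module.finrank_pos_iff.1 hV'
  have hdV : Module.finrank F (V →ₗ[F] F) = Module.finrank F V := Module.finrank_linearMap_self F F V
  have hdV' : Module.finrank F (V' →ₗ[F] F) = Module.finrank F V' :=
    Module.finrank_linearMap_self F F V'
  have : Nontrivial (V →ₗ[F] F) := Module.finrank_pos_iff.1 (hdV ▸ hV)
  have : Nontrivial (V' →ₗ[F] F) := Module.finrank_pos_iff.1 (hdV' ▸ hV')
  have : Finite (V →ₗ[F] F) := Module.finite_of_finite F
  have : Finite (V' →ₗ[F] F) := Module.finite_of_finite F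
  have hcV : Nat.card (V →ₗ[F] F) = Nat.card F ^ Module.finrank F V := by
    rw [Module.natCard_eq_pow_finrank (K := F), hdV]
  have hcV' : Nat.card (V' →ₗ[F] F) = Nat.card F ^ Module.finrank F V' := by
    rw [Module.natCard_eq_pow_finrank (K := F), hdV']
  have hinj0 : ∀ ξ ω, ψ (tens ξ ω) = 0 → ξ = 0 ∨ ω = 0 := by
    intro ξ ω h
    have h0 : tens ξ ω = 0 := ψ.injective (by rw [h, map_zero])
    by_contra! hcon
    exact tens_ne_zero hcon.1 hcon.2 h0
  have hdec : ∀ ξ ω, ∃ ξ' ω', ψ (tens ξ ω) = tens ξ' ω' := fun ξ ω =>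
    exists_eq_tens_of_formRank_le_one (by rw [hrank]; exact formRank_tens_le_one ξ ω)
  let T₁ : (V →ₗ[F] F) → Prop := fun ξ => ∃ q : V →ₗ[F] F, q ≠ 0 ∧
    (∀ ω, ∃ p, ψ (tens ξ ω) = tens q p) ∧ ∀ p, ∃ ω, ψ (tens ξ ω) = tens q p
  let T₂ : (V →ₗ[F] F) → Prop := fun ξ => Module.finrank F V = Module.finrank F V' ∧
    ∃ q : V' →ₗ[F] F, q ≠ 0 ∧
    (∀ ω, ∃ p, ψ (tens ξ ω) = tens p q) ∧ ∀ p, ∃ ω, ψ (tens ξ ω) = tens p q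
  have hT : ∀ ξ, ξ ≠ 0 → T₁ ξ ∨ T₂ ξ := by
    intro ξ hξ
    let b : (V' →ₗ[F] F) →+ (V →ₗ[F] V' →ₗ[F] F) :=
      { toFun := fun ω => ψ (tens ξ ω)
        map_zero' := by rw [tens_zero_right, map_zero]
        map_add' := fun ω ω' => by rw [tens_add_right, map_add] }
    have hb : ∀ ω, b ω = ψ (tens ξ ω) := fun _ => rfl
    have hbinj : Function.Injective b := ψ.injective.comp (tens_right_injective hξ)
    obtain ⟨ω₀, hω₀⟩ := exists_ne (0 : V' →ₗ[F] F)
    rcases exists_common_factor b (hdec ξ) ⟨ω₀, fun h => by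
      rcases hinj0 _ _ h with h | h <;> tauto⟩ with ⟨q, hq, h⟩ | ⟨q, hq, h⟩
    · left
      choose p hp using h
      have hpi : Function.Injective p := fun ω ω' h => hbinj (by rw [hp, hp, h])
      refine ⟨q, hq, fun ω => ⟨p ω, hp ω⟩, fun r => ?_⟩
      obtain ⟨ω, rfl⟩ := Finite.surjective_of_injective hpi r
      exact ⟨ω, hp ω⟩
    · right
      choose p hp using h
      have hpi : Function.Injective p := fun ω ω' h => hbinj (by rw [hp, hp, h])
      -- A common right factor embeds the dual of `V'` into that of `V`, which with `hdim` forces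
      -- equal dimensions.
      have hle := Nat.card_le_card_of_injective p hpi
      rw [hcV, hcV'] at hle
      have hle' := (Nat.pow_le_pow_iff_right (Finite.one_lt_card (α := F))).1 hle
      have heq : Module.finrank F V = Module.finrank F V' := by omega
      have hps := ((Nat.bijective_iff_injective_and_card p).2 ⟨hpi, by rw [hcV, hcV', heq]⟩).2
      refine ⟨heq, q, hq, fun ω => ⟨p ω, hp ω⟩, fun r => ?_⟩
      obtain ⟨ω, rfl⟩ := hps r
      exact ⟨ω, hp ω⟩
  have hind : ∀ ξ ξ' ω ω', ψ (tens ξ ω) = ψ (tens ξ' ω') → ψ (tens ξ ω) ≠ 0 →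
      ∃ c : F, ξ' = c • ξ := by
    intro ξ ξ' ω ω' h h0
    have h' := ψ.injective h
    refine exists_smul_of_tens_eq' (ω := ω') ?_ h'.symm
    rintro rfl
    apply h0
    rw [h, tens_zero_right, map_zero]
  have hall : (∀ ξ, ξ ≠ 0 → T₁ ξ) ∨ ∀ ξ, ξ ≠ 0 → T₂ ξ := by
    by_contra! hcon
    obtain ⟨⟨ξ, hξ, hξ1⟩, ⟨η, hη, hη2⟩⟩ := hcon
    obtain ⟨-, q, hq, -, hξ2⟩ := (hT ξ hξ).resolve_left hξ1
    obtain ⟨q', hq', hη0, hη1⟩ := (hT η hη).resolve_right hη2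
    -- If both types occurred, `tens q' q` would lie in both images. Then `ξ` and `η` would be
    -- proportional and so of the same type.
    obtain ⟨ω, hω⟩ := hξ2 q'
    obtain ⟨ω', hω'⟩ := hη1 q
    obtain ⟨c, hc⟩ := hind η ξ ω' ω (by rw [hω, hω']) (by rw [hω']; exact tens_ne_zero hq' hq)
    have hc0 : c ≠ 0 := by
      rintro rfl
      exact hξ (by rw [hc, zero_smul])
    have hcc : ∀ ω : V' →ₗ[F] F, tens ξ ω = tens η (c • ω) := fun ω => by
      rw [hc, tens_smul_left, tens_smul_right]
    refine hξ1 ⟨q', hq', fun ω => ?_, fun p => ?_⟩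
    · rw [hcc]
      exact hη0 _
    · obtain ⟨ω, hω⟩ := hη1 p
      exact ⟨c⁻¹ • ω, by rw [hcc, smul_smul, mul_inv_cancel₀ hc0, one_smul, hω]⟩
  rcases hall with hall | hall
  · left
    obtain ⟨A, β, hA, hβ, h⟩ := exists_factorization (X := V' →ₗ[F] F) (Y := V →ₗ[F] F) σ
      -- The flip moves the common factor to the right, as `exists_factorization` requires.
      (fun ω ξ => (ψ (tens ξ ω)).flip)
      (fun x x' y => by rw [tens_add_right, map_add]; rfl)
      (fun x y y' => by rw [tens_add_left, map_add]; rfl)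
      (fun c x y => by rw [tens_smul_right, hψ]; rfl)
      (fun c x y => by rw [tens_smul_left, hψ]; rfl)
      (fun ξ hξ => by
        obtain ⟨q, hq, h1, h2⟩ := hall ξ hξ
        refine ⟨q, hq, fun ω => ?_, fun p => ?_⟩
        · obtain ⟨p, hp⟩ := h1 ω
          exact ⟨p, by rw [hp, tens_flip]⟩
        · obtain ⟨ω, hω⟩ := h2 p
          exact ⟨ω, by rw [hω, tens_flip]⟩)
      (fun ω ξ h => by
        have h' := congrArg LinearMap.flip h
        rw [LinearMap.flip_flip] at h'
        exact (hinj0 ξ ω h').symm)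
      (fun ω ω' ξ ξ' h h0 => by
        have h' := congrArg LinearMap.flip h
        rw [LinearMap.flip_flip, LinearMap.flip_flip] at h'
        refine hind _ _ _ _ h' fun h1 => h0 ?_
        rw [h1]; rfl)
    refine ⟨A, β, hA, hβ, fun ξ ω => ?_⟩
    have h' := congrArg LinearMap.flip (h ω ξ)
    rwa [LinearMap.flip_flip, tens_flip] at h'
  · right
    obtain ⟨ξ₀, hξ₀⟩ := exists_ne (0 : V →ₗ[F] F)
    refine ⟨(hall ξ₀ hξ₀).1, ?_⟩
    obtain ⟨A, β, hA, hβ, h⟩ := exists_factorization (X := V' →ₗ[F] F) (Y := V →ₗ[F] F) σ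
      (fun ω ξ => ψ (tens ξ ω))
      (fun x x' y => by rw [tens_add_right, map_add])
      (fun x y y' => by rw [tens_add_left, map_add])
      (fun c x y => by rw [tens_smul_right, hψ])
      (fun c x y => by rw [tens_smul_left, hψ])
      (fun ξ hξ => (hall ξ hξ).2)
      (fun ω ξ h => (hinj0 ξ ω h).symm)
      (fun ω ω' ξ ξ' h h0 => hind _ _ _ _ h h0)
    exact ⟨A, β, hA, hβ, fun ξ ω => h ω ξ⟩

end Classification
end RankMetric

namespace RankMetric

open Finset

/-! ### Images of generalized Gabidulin codes -/

section GabidulinImage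

variable {F L : Type*} [Field F] [Fintype F] [Field L] [Algebra F L] [FiniteDimensional F L]

/-- The linear map given by a linearized polynomial in `y ↦ y ^ q ^ j`. -/
noncomputable def frobPoly (F : Type*) {L : Type*} [Field F] [Fintype F] [Field L] [Algebra F L]
    [FiniteDimensional F L] {t : ℕ} (j : ℕ) (a : Fin t → L) : L →ₗ[F] L :=
  ∑ h, LinearMap.mulLeft F (a h) ∘ₗ
    (FiniteField.frobeniusAlgEquivOfAlgebraic F L ^ (j * (h : ℕ))).toLinearMap

theorem frobPoly_apply {t : ℕ} (j : ℕ) (a : Fin t → L) (y : L) :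
    frobPoly F j a y = ∑ h, a h * y ^ Fintype.card F ^ (j * (h : ℕ)) := by
  simp only [frobPoly, LinearMap.sum_apply, LinearMap.comp_apply, LinearMap.mulLeft_apply,
    AlgEquiv.toLinearMap_apply, frobeniusAlgEquivOfAlgebraic_pow_apply]

/-- The identification of `L` with its dual by the trace form. -/
noncomputable def traceDual (F L : Type*) [Field F] [Fintype F] [Field L] [Algebra F L]
    [FiniteDimensional F L] : L ≃ₗ[F] (L →ₗ[F] F) :=
  LinearMap.BilinForm.toDual (Algebra.traceForm F L) (traceForm_nondegenerate F L)

theorem traceDual_apply (y x : L) : traceDual F L y x = Algebra.trace F L (y * x) := by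
  simp [traceDual, LinearMap.BilinForm.toDual_def, Algebra.traceForm_apply]

theorem trace_traceDual_symm (ω : L →ₗ[F] F) (x : L) :
    Algebra.trace F L ((traceDual F L).symm ω * x) = ω x := by
  rw [← traceDual_apply, LinearEquiv.apply_symm_apply]

/-- The adjoint of a linearized polynomial with respect to the trace form. -/
theorem trace_mul_frobPoly {t : ℕ} {j j' : ℕ}
    (hj : FiniteField.frobeniusAlgEquivOfAlgebraic F L ^ (j + j') = 1) (a : Fin t → L) (y z : L) :
    Algebra.trace F L (y * frobPoly F j a z) = Algebra.trace F L
      (z * frobPoly F j' (fun h => (FiniteField.frobeniusAlgEquivOfAlgebraic F L ^ (j' * (h : ℕ)))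
        (a h)) y) := by
  simp only [frobPoly_apply, Finset.mul_sum, map_sum]
  apply Finset.sum_congr rfl
  intro h _
  simp only [← frobeniusAlgEquivOfAlgebraic_pow_apply]
  -- The trace is invariant under this power of Frobenius, which is inverse to the power acting on
  -- `z`.
  rw [← Algebra.trace_eq_of_algEquiv (FiniteField.frobeniusAlgEquivOfAlgebraic F L ^ (j' * (h : ℕ)))]
  congr 1
  have h1 : ∀ z : L, (FiniteField.frobeniusAlgEquivOfAlgebraic F L ^ (j' * (h : ℕ)))
      ((FiniteField.frobeniusAlgEquivOfAlgebraic F L ^ (j * (h : ℕ))) z) = z := by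
    intro z
    rw [← AlgEquiv.mul_apply, ← pow_add, ← add_mul, add_comm j', pow_mul, hj, one_pow]
    rfl
  simp only [map_mul, h1]
  ring

theorem frobenius_pow_finrank :
    FiniteField.frobeniusAlgEquivOfAlgebraic F L ^ Module.finrank F L = 1 := by
  have : Finite L := Module.finite_of_finite F
  rw [← FiniteField.orderOf_frobeniusAlgEquivOfAlgebraic F L, pow_orderOf_eq_one]

/-- The image of a generalized Gabidulin code under a semilinear isometry consists of the forms
`(x, x') ↦ Tr (A (P (γ x)) * x')`, where `P` runs over linearized polynomials. -/
theorem gabidulin_image {V : Type*} [AddCommGroup V] [Module F V] [FiniteDimensional F V]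
    [Nontrivial V] (hdim : Module.finrank F V ≤ Module.finrank F L)
    {G : Set (V →ₗ[F] L →ₗ[F] F)} (hG : IsGeneralizedGabidulin F L G) (σ : F ≃+* F)
    (ψ : (V →ₗ[F] L →ₗ[F] F) ≃+ (V →ₗ[F] L →ₗ[F] F))
    (hψ : ∀ (c : F) f, ψ (c • f) = σ c • ψ f) (hrank : ∀ f, formRank (ψ f) = formRank f) :
    ∃ (A : L ≃+ L) (γ : V → L) (t j : ℕ), (∀ (c : F) y, A (c • y) = σ c • A y) ∧
      Nat.Coprime j (Module.finrank F L) ∧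
      (∀ f ∈ G, ∃ a : Fin t → L, ∀ x x',
        ψ f x x' = Algebra.trace F L (A (frobPoly F j a (γ x)) * x')) ∧
      ∀ a : Fin t → L, ∃ f ∈ G, ∀ x x',
        ψ f x x' = Algebra.trace F L (A (frobPoly F j a (γ x)) * x') := by
  have : Finite L := Module.finite_of_finite F
  obtain ⟨m, n, b, b', u, g, t, j, hg, -, -, -, hjn, rfl⟩ := hG
  have hn : Module.finrank F L = n := by simpa using Module.finrank_eq_card_basis b'
  have hm : Module.finrank F V = m := by simpa using Module.finrank_eq_card_basis b
  let Φ : L ≃ₗ[F] (L →ₗ[F] F) := u.equivFun.trans (b'.constr F)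
  have hΦ : ∀ y l, Φ y (b' l) = u.repr y l := fun y l => by
    simp [Φ]
  let D := traceDual F L
  have hD : ∀ ω x, Algebra.trace F L (D.symm ω * x) = ω x := trace_traceDual_symm
  -- membership in the code, row by row
  have hmem : ∀ f : V →ₗ[F] L →ₗ[F] F,
      LinearMap.toMatrix₂ b b' f ∈ gabidulinMatrices F u g t j ↔
      ∃ a : Fin t → L, ∀ i, f (b i) = Φ (frobPoly F j a (g i)) := by
    intro f
    refine exists_congr fun a => forall_congr' fun i => ?_
    constructor
    · intro h
      apply b'.ext
      intro l
      rw [hΦ, frobPoly_apply, ← h l, LinearMap.toMatrix₂_apply]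
    · intro h l
      rw [LinearMap.toMatrix₂_apply, h, hΦ, frobPoly_apply]
  have hex : ∀ a : Fin t → L, ∃ f : V →ₗ[F] L →ₗ[F] F,
      ∀ i, f (b i) = Φ (frobPoly F j a (g i)) := fun a =>
    ⟨b.constr F fun i => Φ (frobPoly F j a (g i)), fun i => by rw [b.constr_basis]⟩
  have hV : 0 < Module.finrank F V := Module.finrank_pos
  have hdV : Module.finrank F (V →ₗ[F] F) = Module.finrank F V := Module.finrank_linearMap_self F F V
  have : Nontrivial (V →ₗ[F] F) := Module.finrank_pos_iff.1 (hdV ▸ hV)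
  have hdL : Module.finrank F (L →ₗ[F] F) = Module.finrank F L := Module.finrank_linearMap_self F F L
  have : Nontrivial (L →ₗ[F] F) := Module.finrank_pos_iff.1 (by rw [hdL]; omega)
  have hzero : ∀ (ξ : V →ₗ[F] F) (ω : L →ₗ[F] F), ψ (tens ξ ω) = 0 → ξ = 0 ∨ ω = 0 := by
    intro ξ ω h
    have h0 : tens ξ ω = 0 := ψ.injective (by rw [h, map_zero])
    by_contra! hcon
    exact tens_ne_zero hcon.1 hcon.2 h0
  rcases rank_preserver_classification hdim σ ψ hψ hrank with
    ⟨A, β, hA, hβ, h⟩ | ⟨heq, A, β, hA, hβ, h⟩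
  · obtain ⟨ξ₀, hξ₀⟩ := exists_ne (0 : V →ₗ[F] F)
    have hAinj : Function.Injective A := by
      rw [injective_iff_map_eq_zero]
      intro ω hω
      exact (hzero ξ₀ ω (by rw [h, hω, tens_zero_right])).resolve_left hξ₀
    let A₁ : L →+ L := (D.symm : (L →ₗ[F] F) →+ L).comp (A.comp (Φ : L →+ (L →ₗ[F] F)))
    have hA₁ : ∀ y, A₁ y = D.symm (A (Φ y)) := fun _ => rfl
    have hA₁inj : Function.Injective A₁ :=
      D.symm.injective.comp (hAinj.comp Φ.injective)
    let A₂ : L ≃+ L := AddEquiv.ofBijective A₁ ⟨hA₁inj, Finite.surjective_of_injective hA₁inj⟩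
    have hA₂ : ∀ y, A₂ y = D.symm (A (Φ y)) := fun _ => rfl
    -- The values `β (b.coord i) x` are scalars, so they pass through `A`, `Φ` and the `F`-linear
    -- polynomial into its argument.
    have key : ∀ (a : Fin t → L) (f : V →ₗ[F] L →ₗ[F] F),
        (∀ i, f (b i) = Φ (frobPoly F j a (g i))) → ∀ x x', ψ f x x' = Algebra.trace F L
          (A₂ (frobPoly F j a (∑ i, σ.symm (β (b.coord i) x) • g i)) * x') := by
      intro a f hf x x'
      conv_lhs => rw [eq_sum_tens b f]
      rw [hA₂, hD]
      simp only [map_sum, map_smul, LinearMap.sum_apply, h, hf, tens_apply, hA,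
        LinearMap.smul_apply, RingEquiv.apply_symm_apply, smul_eq_mul]
    refine ⟨A₂, fun x => ∑ i, σ.symm (β (b.coord i) x) • g i, t, j, ?_, hn ▸ hjn, ?_, ?_⟩
    · intro c y
      rw [hA₂, map_smul, hA, map_smul, ← hA₂]
    · intro f hf
      obtain ⟨a, ha⟩ := (hmem f).1 hf
      exact ⟨a, key a f ha⟩
    · intro a
      obtain ⟨f, hf⟩ := hex a
      exact ⟨f, (hmem f).2 ⟨a, hf⟩, key a f hf⟩
  · obtain ⟨ω₀, hω₀⟩ := exists_ne (0 : L →ₗ[F] F)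
    have hβinj : ∀ ξ, β ξ = 0 → ξ = 0 := fun ξ hξ =>
      (hzero ξ ω₀ (by rw [h, hξ, tens_zero_right])).resolve_right hω₀
    let A₁ : L →+ L :=
      { toFun := fun y => ∑ i, σ (Algebra.trace F L (g i * y)) • D.symm (β (b.coord i))
        map_zero' := by simp
        map_add' := fun y z => by simp [mul_add, add_smul, Finset.sum_add_distrib] }
    have hA₁ : ∀ y, A₁ y = ∑ i, σ (Algebra.trace F L (g i * y)) • D.symm (β (b.coord i)) :=
      fun _ => rfl
    -- Exchanged factors occur only for equal dimensions, and then the `g i` form a basis of `L`.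
    have hspan : Submodule.span F (Set.range g) = ⊤ :=
      hg.span_eq_top_of_card_eq_finrank' (by rw [Fintype.card_fin, ← hm, heq])
    have hA₁inj : Function.Injective A₁ := by
      rw [injective_iff_map_eq_zero]
      intro y hy
      have h1 : D.symm (β (∑ i, Algebra.trace F L (g i * y) • b.coord i)) = 0 := by
        rw [← hy, hA₁]
        simp only [map_sum, hβ, map_smul]
      have h2 := hβinj _ (D.symm.map_eq_zero_iff.1 h1)
      have h3 : ∀ i, Algebra.trace F L (g i * y) = 0 := by
        intro i
        have := congrArg (fun ξ => ξ (b i)) h2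
        simpa [Finsupp.single_apply] using this
      apply D.map_eq_zero_iff.1
      refine LinearMap.ext_on hspan ?_
      rintro _ ⟨i, rfl⟩
      rw [traceDual_apply, mul_comm, h3, LinearMap.zero_apply]
    let A₂ : L ≃+ L := AddEquiv.ofBijective A₁ ⟨hA₁inj, Finite.surjective_of_injective hA₁inj⟩
    have hA₂ : ∀ y, A₂ y = ∑ i, σ (Algebra.trace F L (g i * y)) • D.symm (β (b.coord i)) :=
      fun _ => rfl
    let κ : V → L := fun x => D.symm
      { toFun := fun y => σ.symm (A (Φ y) x)
        map_add' := fun y z => by simp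
        map_smul' := fun c y => by simp [hA] }
    have hκ : ∀ x y, σ (Algebra.trace F L (κ x * y)) = A (Φ y) x := by
      intro x y
      simp only [κ, hD]
      simp
    -- The exchange replaces polynomials by their adjoints for the trace form. Thus `j` becomes `-j`
    -- modulo `n`, represented by a natural number.
    set j' := j * (n - 1) with hj'
    have hn1 : 1 ≤ n := by omega
    have hjj : j + j' = n * j := by
      obtain ⟨l, rfl⟩ := Nat.exists_eq_add_of_le hn1
      rw [hj', Nat.add_sub_cancel_left]
      ring
    have hφ : FiniteField.frobeniusAlgEquivOfAlgebraic F L ^ (j + j') = 1 := by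
      rw [hjj, pow_mul, ← hn, frobenius_pow_finrank, one_pow]
    have key : ∀ (a : Fin t → L) (f : V →ₗ[F] L →ₗ[F] F),
        (∀ i, f (b i) = Φ (frobPoly F j a (g i))) → ∀ x x', ψ f x x' = Algebra.trace F L
          (A₂ (frobPoly F j' (fun h => (FiniteField.frobeniusAlgEquivOfAlgebraic F L ^
            (j' * (h : ℕ))) (a h)) (κ x)) * x') := by
      intro a f hf x x'
      conv_lhs => rw [eq_sum_tens b f]
      rw [hA₂, Finset.sum_mul]
      simp only [map_sum, map_smul, LinearMap.sum_apply, h, hf, tens_apply, smul_mul_assoc, hD,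
        smul_eq_mul, ← hκ, trace_mul_frobPoly hφ]
    refine ⟨A₂, κ, t, j', ?_, ?_, ?_, ?_⟩
    · intro c y
      rw [hA₂, hA₂, Finset.smul_sum]
      simp [smul_smul]
    · rw [hn]
      refine Nat.Coprime.mul_left hjn ?_
      obtain ⟨l, rfl⟩ := Nat.exists_eq_add_of_le hn1
      simp
    · intro f hf
      obtain ⟨a, ha⟩ := (hmem f).1 hf
      exact ⟨_, key a f ha⟩
    · intro a
      obtain ⟨f, hf⟩ := hex fun h =>
        (FiniteField.frobeniusAlgEquivOfAlgebraic F L ^ (j' * (h : ℕ))).symm (a h)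
      refine ⟨f, (hmem f).2 ⟨_, hf⟩, ?_⟩
      have := key _ f hf
      simpa only [AlgEquiv.apply_symm_apply] using this

end GabidulinImage
end RankMetric

namespace RankMetric

open Finset

/-! ### The punctured code in coordinates -/

section Coordinates

variable {F L : Type*} [Field F] [Fintype F] [Field L] [Algebra F L] [FiniteDimensional F L]

theorem sum_zmod_eq_sum_range {M : Type*} [AddCommMonoid M] {m : ℕ} [NeZero m] (f : ZMod m → M) :
    ∑ i, f i = ∑ i ∈ range m, f (i : ZMod m) := by
  refine Finset.sum_nbij' (fun i => i.val) (fun i => (i : ZMod m)) ?_ ?_ ?_ ?_ ?_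
  · intro i _
    exact Finset.mem_range.2 (ZMod.val_lt i)
  · intro i _
    exact Finset.mem_univ _
  · intro i _
    exact ZMod.natCast_zmod_val i
  · intro i hi
    exact ZMod.val_natCast_of_lt (Finset.mem_range.1 hi)
  · intro i _
    rw [ZMod.natCast_zmod_val]

/-- The powers of an automorphism of order `m`, indexed by `ZMod m`. -/
def zmodPow {K : IntermediateField F L} (m : ℕ) (τ : K ≃ₐ[F] K) (i : ZMod m) : K ≃ₐ[F] K :=
  τ ^ i.val

section ZModPow

variable {K : IntermediateField F L} {m : ℕ} [NeZero m] {τ : K ≃ₐ[F] K}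

omit [Fintype F] [FiniteDimensional F L] in
theorem zmodPow_intCast (hτ : orderOf τ = m) (z : ℤ) : zmodPow m τ (z : ZMod m) = τ ^ z := by
  unfold zmodPow
  rw [← zpow_natCast, ZMod.val_intCast, ← hτ, zpow_mod_orderOf]

omit [Fintype F] [FiniteDimensional F L] in
theorem zmodPow_add (hτ : orderOf τ = m) (i j : ZMod m) :
    zmodPow m τ (i + j) = zmodPow m τ i * zmodPow m τ j := by
  rw [← ZMod.intCast_zmod_cast i, ← ZMod.intCast_zmod_cast j, ← Int.cast_add, zmodPow_intCast hτ,
    zmodPow_intCast hτ, zmodPow_intCast hτ, zpow_add]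

omit [Fintype F] [FiniteDimensional F L] in
theorem zmodPow_injective (hτ : orderOf τ = m) : Function.Injective (zmodPow m τ) := by
  intro i j h
  apply ZMod.val_injective
  exact pow_injOn_Iio_orderOf (by rw [hτ]; exact ZMod.val_lt i) (by rw [hτ]; exact ZMod.val_lt j) h

end ZModPow

/-- The members of the punctured code are the forms `(x, x') ↦ Tr (T x * x')`, where the
coefficients of `T` form a vector of `twistedCoeffs`. -/
theorem mem_puncturedTwistedGabidulin_iff {K : IntermediateField F L} {m : ℕ} [NeZero m]
    {τ' : K ≃ₐ[F] K} (hτ' : orderOf τ' = m) {k t : ℕ} (h0 : 0 < t) (htm : t < m) {μ : L} {s : ℤ}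
    (τ : L ≃ₐ[F] L) (hτ : τ = (FiniteField.frobeniusAlgEquivOfAlgebraic F L ^ k)⁻¹)
    (hres : ∀ (z : ℤ) (κ : K), (τ ^ z) (κ : L) = (τ' ^ z) κ)
    {N : L →+ L} (hN : ∀ y, N y = (τ ^ (t : ℤ)) μ * (τ ^ ((t : ℤ) - s)) y)
    (f : K →ₗ[F] L →ₗ[F] F) :
    f ∈ puncturedTwistedGabidulin F K t μ s k ↔ ∃ v ∈ twistedCoeffs m t N,
      ∀ x x', f x x' = Algebra.trace F L (expand (zmodPow m τ') v x * x') := by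
  have hexp : ∀ v ∈ twistedCoeffs m t N, ∀ x, expand (zmodPow m τ') v x =
      v 0 * x + N (v 0) * (τ ^ (t : ℤ)) x + ∑ j ∈ Ico 1 t, v (j : ZMod m) * (τ ^ (j : ℤ)) x := by
    intro v hv x
    have h1 : ∀ j : ℕ, (zmodPow m τ' (j : ZMod m) x : L) = (τ ^ (j : ℤ)) x := by
      intro j
      have := zmodPow_intCast hτ' (j : ℤ)
      rw [Int.cast_natCast] at this
      rw [this, hres]
    unfold expand
    rw [sum_zmod_eq_sum_range]
    simp only [h1]
    rw [← Finset.sum_subset (Finset.range_subset_range.2 (by omega : t + 1 ≤ m)), Finset.sum_range_succ,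
      hv.2, Finset.range_eq_Ico, Finset.sum_eq_sum_Ico_succ_bot h0]
    · simp only [Nat.cast_zero, zpow_zero, AlgEquiv.one_apply, zero_add]
      ring
    · intro j hj hj'
      rw [eq_zero_of_mem_twistedCoeffs hv (by simpa using hj') (by simpa using hj), zero_mul]
  have htr : ∀ (a : L) (j : ℕ) (x x' : L), traceForm F k a j x x' =
      Algebra.trace F L ((τ ^ (j : ℤ)) a * (τ ^ (j : ℤ)) x * x') := by
    intro a j x x'
    have h1 : traceForm F k a j x x' =
        Algebra.trace F L (a * x * x' ^ (Fintype.card F ^ (k * j))) := rfl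
    -- `τ` inverts the Frobenius power, so applying `τ ^ j` inside the trace frees `x'` and puts the
    -- twist on `a` and `x`.
    have h2 : (τ ^ (j : ℤ)) (x' ^ (Fintype.card F ^ (k * j))) = x' := by
      rw [← frobeniusAlgEquivOfAlgebraic_pow_apply, ← AlgEquiv.mul_apply, hτ, zpow_natCast, inv_pow,
        ← pow_mul, inv_mul_cancel, AlgEquiv.one_apply]
    rw [h1, ← Algebra.trace_eq_of_algEquiv (τ ^ (j : ℤ)), map_mul (τ ^ (j : ℤ)),
      map_mul (τ ^ (j : ℤ)), h2]
  have hNt : ∀ a, (τ ^ (t : ℤ)) (μ * (FiniteField.frobeniusAlgEquivOfAlgebraic F L ^ (s * (k : ℤ))) a)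
      = N a := by
    intro a
    rw [hN, map_mul, ← AlgEquiv.mul_apply, hτ]
    congr 2
    rw [zpow_sub, mul_comm s, zpow_mul, zpow_natCast _ k, inv_zpow _ s, inv_inv]
  have hform : ∀ (a : L) (c : ℕ → L) (x x' : L), (traceForm F k a 0 + traceForm F k
      (μ * (FiniteField.frobeniusAlgEquivOfAlgebraic F L ^ (s * (k : ℤ))) a) t
      + ∑ j ∈ Finset.Ico 1 t, traceForm F k (c j) j) x x' = Algebra.trace F L
      ((a * x + N a * (τ ^ (t : ℤ)) x + ∑ j ∈ Ico 1 t, (τ ^ (j : ℤ)) (c j) * (τ ^ (j : ℤ)) x)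
        * x') := by
    intro a c x x'
    simp only [LinearMap.add_apply, LinearMap.sum_apply, htr, hNt, add_mul, Finset.sum_mul,
      map_add, map_sum, Nat.cast_zero, zpow_zero, AlgEquiv.one_apply]
  constructor
  · rintro ⟨_, ⟨a, c, rfl⟩, rfl⟩
    let v : ZMod m → L := fun i => if i = 0 then a else if i = t then N a else
      if i.val < t then (τ ^ (i.val : ℤ)) (c i.val) else 0
    have hv0 : v 0 = a := by simp [v]
    have htv : ((t : ℕ) : ZMod m).val = t := ZMod.val_natCast_of_lt htm
    have hvt : v t = N a := by
      have : (t : ZMod m) ≠ 0 := by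
        intro h
        rw [h, ZMod.val_zero] at htv
        omega
      simp [v, this]
    have hv : v ∈ twistedCoeffs m t N := by
      refine ⟨fun i hi => ?_, by rw [hvt, hv0]⟩
      have h1 : i ≠ 0 := by rintro rfl; simp at hi
      have h2 : i ≠ t := by rintro rfl; omega
      have h3 : ¬ i.val < t := by omega
      simp [v, h1, h2, h3]
    refine ⟨v, hv, fun x x' => ?_⟩
    rw [hexp v hv, hv0]
    refine (hform a c x x').trans ?_
    congr 3
    apply Finset.sum_congr rfl
    intro j hj
    rw [Finset.mem_Ico] at hj
    have hjv : ((j : ℕ) : ZMod m).val = j := ZMod.val_natCast_of_lt (by omega)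
    have h1 : (j : ZMod m) ≠ 0 := by intro h; rw [h, ZMod.val_zero] at hjv; omega
    have h2 : (j : ZMod m) ≠ t := by intro h; rw [h] at hjv; omega
    simp only [v, h1, h2, hjv, hj.2, if_false, if_true]
  · rintro ⟨v, hv, h⟩
    refine ⟨_, ⟨v 0, fun j => (τ ^ (j : ℤ)).symm (v j), rfl⟩, ?_⟩
    ext x x'
    rw [h, hexp v hv]
    refine (hform _ _ x x').trans ?_
    simp only [AlgEquiv.apply_symm_apply]

end Coordinates

end RankMetric

/-! ### Reduction of the theorem to coefficient vectors -/

theorem mainTheorem1 {F L : Type*} [Field F] [Fintype F] [Field L] [Algebra F L]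
    [FiniteDimensional F L] (K : IntermediateField F L)
    (m n : ℕ) (hm : 1 < m) (hmn : m ∣ n)
    (hK : Module.finrank F K = m) (hL : Module.finrank F L = n)
    (k : ℕ) (hk : 1 ≤ k) (hkn : Nat.Coprime k n)
    (t : ℕ) (ht1 : 1 ≤ t) (ht2 : t + 2 ≤ m)
    (μ : L) (hμ0 : μ ≠ 0) (hμ : Algebra.norm F μ ≠ (-1) ^ (n * t))
    (s : ℤ)
    (hs : ¬ s ≡ 0 [ZMOD m] ∧ ¬ s ≡ 1 [ZMOD m] ∧ ¬ s ≡ -1 [ZMOD m] ∧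
      ¬ s ≡ 2 [ZMOD m] ∧ ¬ s ≡ -2 [ZMOD m])
    (hgcd : Int.gcd n (s * k - t) < m)
    (G : Set (K →ₗ[F] L →ₗ[F] F)) (hG : RankMetric.IsGeneralizedGabidulin F L G) :
    ¬ RankMetric.CodeEquivalent (RankMetric.puncturedTwistedGabidulin F K t μ s k) G := by
  rintro ⟨σ, φ, hφ, hrank, hφG⟩
  have : Finite L := Module.finite_of_finite F
  have : NeZero m := ⟨by omega⟩
  set P := RankMetric.puncturedTwistedGabidulin F K t μ s k with hP
  let frK := FiniteField.frobeniusAlgEquivOfAlgebraic F K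
  let frL := FiniteField.frobeniusAlgEquivOfAlgebraic F L
  have hfr : ∀ (z : ℤ) (κ : K), (frL ^ z) (κ : L) = (frK ^ z) κ := by
    have h1 : AlgEquiv.restrictNormalHom K frL = frK := by
      ext κ
      have := AlgEquiv.restrictNormal_commutes frL K κ
      simp only [IntermediateField.algebraMap_apply] at this
      refine this.trans ?_
      simp [frL, frK]
    intro z κ
    have := AlgEquiv.restrictNormal_commutes (frL ^ z) K κ
    simp only [IntermediateField.algebraMap_apply] at this
    rw [← this, ← h1, ← map_zpow]
    rfl
  have hfrK : orderOf frK = m := by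
    rw [← hK]
    exact FiniteField.orderOf_frobeniusAlgEquivOfAlgebraic F K
  have hkm : Nat.Coprime k m := Nat.Coprime.coprime_dvd_right hmn hkn
  set τ' : K ≃ₐ[F] K := (frK ^ k)⁻¹ with hτ'
  have hτo : orderOf τ' = m := by
    rw [hτ', orderOf_inv, Nat.Coprime.orderOf_pow (by rw [hfrK]; exact hkm.symm), hfrK]
  set τ : L ≃ₐ[F] L := (frL ^ k)⁻¹ with hτ
  have hres : ∀ (z : ℤ) (κ : K), (τ ^ z) (κ : L) = (τ' ^ z) κ := by
    intro z κ
    have h1 : τ ^ z = frL ^ (-(k : ℤ) * z) := by rw [hτ, zpow_mul, zpow_neg, zpow_natCast]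
    have h2 : τ' ^ z = frK ^ (-(k : ℤ) * z) := by rw [hτ', zpow_mul, zpow_neg, zpow_natCast]
    rw [h1, h2, hfr]
  let N : L →+ L := (AddMonoidHom.mulLeft ((τ ^ (t : ℤ)) μ)).comp
    ((τ ^ ((t : ℤ) - s) : L ≃ₐ[F] L) : L →+ L)
  have hN : ∀ y, N y = (τ ^ (t : ℤ)) μ * (τ ^ ((t : ℤ) - s)) y := fun _ => rfl
  have hμt : (τ ^ (t : ℤ)) μ ≠ 0 := (map_ne_zero_iff _ (τ ^ (t : ℤ)).injective).2 hμ0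
  have hNinj : Function.Injective N :=
    (mul_right_injective₀ hμt).comp (τ ^ ((t : ℤ) - s)).injective
  have hmem := RankMetric.mem_puncturedTwistedGabidulin_iff hτo (by omega : 0 < t)
    (by omega : t < m) τ hτ hres hN
  -- the equivalence, read backwards
  have hsymm : ∀ (c : F) f, φ.symm (c • f) = σ.symm c • φ.symm f := by
    intro c f
    apply φ.injective
    simp [hφ]
  have hrank' : ∀ f, RankMetric.formRank (φ.symm f) = RankMetric.formRank f := by
    intro f
    rw [← hrank, AddEquiv.apply_symm_apply]
  have hnpos : 0 < n := hL ▸ Module.finrank_pos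
  have : Nontrivial K := inferInstance
  obtain ⟨A, γ, t', j, hA, hj, hG1, hG2⟩ := RankMetric.gabidulin_image
    (by rw [hK, hL]; exact Nat.le_of_dvd hnpos hmn) hG σ.symm φ.symm hsymm hrank'
  rw [hL] at hj
  have hPG : ∀ f, f ∈ G ↔ φ.symm f ∈ P := by
    intro f
    rw [← hφG]
    constructor
    · rintro ⟨p, hp, rfl⟩
      rwa [AddEquiv.symm_apply_apply]
    · intro h
      exact ⟨_, h, AddEquiv.apply_symm_apply _ _⟩
  have htrace : ∀ y z : L, (∀ x', Algebra.trace F L (y * x') = Algebra.trace F L (z * x')) →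
      y = z := by
    intro y z h
    apply (RankMetric.traceDual F L).injective
    ext x'
    rw [RankMetric.traceDual_apply, RankMetric.traceDual_apply, h]
  have hsurj : ∀ g : K ≃ₐ[F] K, ∃ d, RankMetric.zmodPow m τ' d = g := by
    have hc : Nat.card (K ≃ₐ[F] K) = Nat.card (ZMod m) := by
      rw [IsGalois.card_aut_eq_finrank, hK, Nat.card_zmod]
    exact ((Nat.bijective_iff_injective_and_card _).2
      ⟨RankMetric.zmodPow_injective hτo, hc.symm⟩).2
  have hpow : ∀ (i : ℕ) (κ : K), (κ : L) ^ Fintype.card F ^ i = ((frK ^ i) κ : K) := by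
    intro i κ
    rw [← RankMetric.frobeniusAlgEquivOfAlgebraic_pow_apply]
    have := hfr i κ
    rwa [zpow_natCast, zpow_natCast] at this
  -- `d` is the shift by which the Frobenius map of the Gabidulin code acts on coefficients.
  obtain ⟨d, hd⟩ := hsurj (frK ^ j)
  refine RankMetric.twistedCoeffs_ne_gabidulin (χ := RankMetric.zmodPow m τ') (t := t) (N := N)
    (e := (((t : ℤ) - s : ℤ) : ZMod m)) (RankMetric.zmodPow_add hτo)
    (RankMetric.zmodPow_injective hτo) ?_ ⟨hNinj, Finite.surjective_of_injective hNinj⟩ ?_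
    (by omega) ht2 ?_ ?_ σ.symm A hA γ t' j (d := d) ?_ ?_ ?_
  · intro g
    obtain ⟨i, hi⟩ := (FiniteField.bijective_frobeniusAlgHom_pow F L).2 g
    obtain ⟨d, hd⟩ := hsurj (frK ^ (i : ℕ))
    refine ⟨d, fun κ => ?_⟩
    rw [hd, ← hpow, ← hi]
    simp [AlgHom.coe_pow, FiniteField.coe_frobeniusAlgHom, pow_iterate]
  · intro κ y
    rw [hN, hN, map_mul, hres, RankMetric.zmodPow_intCast hτo]
    ring
  · intro h
    apply hs.1
    rw [← ZMod.intCast_eq_intCast_iff]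
    push_cast at h ⊢
    linear_combination -h
  -- Here `s ≡ t`: `t = 1` is excluded by `s ≢ 1`, and `t = m - 2` by `s ≢ -2`.
  · intro h
    have h' : ((t : ℤ) : ZMod m) = (s : ZMod m) := by
      push_cast at h ⊢
      linear_combination h
    constructor
    · by_contra hlt
      have : t = 1 := by omega
      apply hs.2.1
      rw [← ZMod.intCast_eq_intCast_iff, ← h', this]
      simp
    · by_contra hlt
      have : (m : ℤ) = t + 2 := by omega
      apply hs.2.2.2.2
      rw [← ZMod.intCast_eq_intCast_iff, ← h', show (t : ℤ) = m + -2 by omega]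
      simp
  -- A zero shift would mean that `m` divides both `j` and `n`, which are coprime.
  · rintro rfl
    have h1 : frK ^ j = 1 := by
      rw [← hd, RankMetric.zmodPow, ZMod.val_zero, pow_zero]
    have h2 := orderOf_dvd_of_pow_eq_one h1
    rw [hfrK] at h2
    have := Nat.dvd_gcd h2 hmn
    rw [hj] at this
    have := Nat.le_of_dvd one_pos this
    omega
  · intro κ
    rw [hd, hpow]
  · intro f
    simp only [RankMetric.frobPoly_apply] at hG1 hG2
    constructor
    · rintro ⟨v, hv, rfl⟩
      obtain ⟨B, hB⟩ : ∃ B : K →ₗ[F] L →ₗ[F] F, ∀ x x', B x x' =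
          Algebra.trace F L (RankMetric.expand (RankMetric.zmodPow m τ') v x * x') := by
        refine ⟨LinearMap.mk₂ F (fun x x' => Algebra.trace F L
          (RankMetric.expand (RankMetric.zmodPow m τ') v x * x')) ?_ ?_ ?_ ?_, fun _ _ => rfl⟩
        · intro x y z
          simp [RankMetric.expand, mul_add, Finset.sum_add_distrib, add_mul]
        · intro c x z
          rw [← map_smul, ← smul_mul_assoc]
          simp [RankMetric.expand, Finset.smul_sum]
        · intro x y z
          simp [mul_add]
        · intro c x z
          simp
      have hBP : B ∈ P := (hmem B).2 ⟨v, hv, hB⟩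
      obtain ⟨a, ha⟩ := hG1 (φ B) ((hPG _).2 (by rwa [AddEquiv.symm_apply_apply]))
      refine ⟨a, fun x => htrace _ _ fun x' => ?_⟩
      rw [← hB, ← ha, AddEquiv.symm_apply_apply]
    · rintro ⟨a, ha⟩
      obtain ⟨g, hg, hg'⟩ := hG2 a
      obtain ⟨v, hv, hv'⟩ := (hmem _).1 ((hPG g).1 hg)
      refine ⟨v, hv, ?_⟩
      funext x
      refine htrace _ _ fun x' => ?_
      rw [ha, ← hg', hv']
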